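/- \textbf{Setting.} A $\{\mathrm{CNOT},T\}$ circuit on $n$ qubits is a finite list of gates CNOT (on two distinct qubits), $T$, $P=T^2$ and $Z=T^4$, where $T|x\rangle=e^{i\pi x/4}|x\rangle$; its $T$-count is its number of $T$ gates, and two circuits are equivalent if they have the same unitary. \emph{$T$-count minimization}: given a circuit on $n$ qubits, find an equivalent one with the least $T$-count. For $n\ge 0$ and $r\in\mathbb Z$, $\mathcal{RM}(r,n)^*\subseteq\mathbb F_2^{2^n-1}$ is the set of evaluation vectors, on the non-zero points of $\mathbb F_2^n$, of the polynomials in $\mathbb F_2[v_1,\dots,v_n]$ of degree at most $r$ (so it is $\{0\}$ for $r<0$). \emph{Minimum distance decoding} for a code $C$: given a word $x$, find $y\in C$ with $d(x,y)\le d(x,z)$ for all $z\in C$, where $d$ is the Hamming distance. For $a\in\mathbb Z_8^{2^n-1}$, indexed by the non-zero $y\in\mathbb F_2^n$, let $P_a(x)=\sum_{y\ne 0}a_y\,(y_1x_1\oplus\cdots\oplus y_nx_n)\in\mathbb Z_8$ and $U_{P_a}|x\rangle=e^{i\frac{\pi}{4}P_a(x)}|x\rangle$; let $\mathrm{Res}_2(a)\in\mathbb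 F_2^{2^n-1}$ be the componentwise residue modulo $2$. Say that $a$ \emph{implements} a circuit $C$ if the unitary of $C$ is $U_{P_a}$ followed by the unitary of some circuit of CNOT gates. A search problem $A$ with parameter $n$ \emph{reduces} to a search problem $B$ with parameter $n$ if there are maps $f$, $g$ such that, for every $n$, $f$ maps the instances of $A$ with parameter $n$ to instances of $B$ with parameter $n$, and $g(x,s)$ is a solution of $x$ for every solution $s$ of $f(x)$, where $f$ and $g$ are computed, uniformly in $n$, by random access machine programs (addition, truncated subtraction, halving; unit cost) in a number of steps polynomial in $2^n$ plus the length of their input (for $g$: the lengths of $x$ and $s$). A word in $\mathbb F_2^{2^n-1}$ has length $2^n-1$; the length of a circuit is proportional to its number of gates. \textbf{Theorem 1.} $T$-count minimization for $n$-qubit $\{\mathrm{CNOT},T\}$ circuits and minimum distance decoding for $\mathcal{RM}(n-4,n)^*$ are polynomial-time (in $2^n$) equivalent: each reduces to the other. Moreover, for every $n$: (a) For every $n$-qubit circuit $C$, the least $T$-count of a circuit equivalent to $C$ equals the least number of odd coefficients of a tuple $a\in\mathbb Z_8^{2^n-1}$ that implements $C$. (b) There are maps, computable in time polynomial in $2^n$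 plus the length of the input, uniformly in $n$, that send every $n$-qubit circuit $C$ to a tuple $a(C)$ that implements $C$ and has at most as many odd coefficients as $C$ has $T$ gates, and every tuple $a\in\mathbb Z_8^{2^n-1}$ to an $n$-qubit circuit $S(a)$ with unitary $U_{P_a}$ whose $T$-count is the number of odd coefficients of $a$. (c) With the maps of (b), the reductions can be taken as follows. From $T$-count minimization to decoding: $C\mapsto\mathrm{Res}_2(a(C))$, followed by a map $R$ such that, for every codeword $w\in\mathcal{RM}(n-4,n)^*$, $R(C,w)$ is a circuit equivalent to $C$ with $T$-count $d(\mathrm{Res}_2(a(C)),w)$. From decoding to $T$-count minimization: $x\mapsto S(x)$, where $x$ is read as a tuple with entries $0,1$ in $\mathbb Z_8$, followed by $(x,D)\mapsto x\oplus\mathrm{Res}_2(a(D))$. -/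

import Mathlib

open scoped Matrix

namespace TCount

noncomputable section

/-! ### Random access machine with a step count

Programs are structured (`while`) programs over a random access memory: scalar registers `reg r`
and arrays `arr a i` of natural numbers, with addition, truncated subtraction, halving and array
access. Every node of an expression, every assignment and every test costs one unit. There is no
multiplication, so unit-cost polynomial time is polynomial time on a Turing machine. -/

/-- A memory of the machine. -/
structure Mem where
  reg : ℕ → ℕ
  arr : ℕ → ℕ → ℕ

/-- Expressions. -/
inductive Expr : Type
  | num (c : ℕ)
  | var (r : ℕ)
  | read (a : ℕ) (i : Expr)
  | plus (e f : Expr)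
  | minus (e f : Expr)
  | half (e : Expr)

/-- The value of an expression (subtraction is truncated at `0`, `half` rounds down). -/
def Expr.eval (s : Mem) : Expr → ℕ
  | .num c => c
  | .var r => s.reg r
  | .read a i => s.arr a (i.eval s)
  | .plus e f => e.eval s + f.eval s
  | .minus e f => e.eval s - f.eval s
  | .half e => e.eval s / 2

/-- The cost of evaluating an expression: its number of nodes. -/
def Expr.cost : Expr → ℕ
  | .num _ => 1
  | .var _ => 1
  | .read _ i => i.cost + 1
  | .plus e f => e.cost + f.cost + 1
  | .minus e f => e.cost + f.cost + 1
  | .half e => e.cost + 1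

/-- Commands (programs). A test `e` succeeds when its value is non-zero. -/
inductive Cmd : Type
  | skip
  | assign (r : ℕ) (e : Expr)
  | write (a : ℕ) (i e : Expr)
  | seq (c d : Cmd)
  | ite (e : Expr) (c d : Cmd)
  | loop (e : Expr) (c : Cmd)

/-- `reg r := v`. -/
def Mem.setReg (s : Mem) (r v : ℕ) : Mem :=
  { s with reg := Function.update s.reg r v }

/-- `arr a i := v`. -/
def Mem.setArr (s : Mem) (a i v : ℕ) : Mem :=
  { s with arr := Function.update s.arr a (Function.update (s.arr a) i v) }

/-- `Exec c s t s'`: the program `c`, started in memory `s`, halts after `t` steps in memory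
`s'`. -/
inductive Exec : Cmd → Mem → ℕ → Mem → Prop
  | skip (s : Mem) : Exec .skip s 1 s
  | assign (s : Mem) (r : ℕ) (e : Expr) :
      Exec (.assign r e) s (e.cost + 1) (s.setReg r (e.eval s))
  | write (s : Mem) (a : ℕ) (i e : Expr) :
      Exec (.write a i e) s (i.cost + e.cost + 1) (s.setArr a (i.eval s) (e.eval s))
  | seq {c d : Cmd} {s s' s'' : Mem} {t t' : ℕ} :
      Exec c s t s' → Exec d s' t' s'' → Exec (.seq c d) s (t + t') s''
  | iteTrue {e : Expr} {c d : Cmd} {s s' : Mem} {t : ℕ} :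
      e.eval s ≠ 0 → Exec c s t s' → Exec (.ite e c d) s (e.cost + 1 + t) s'
  | iteFalse {e : Expr} {c d : Cmd} {s s' : Mem} {t : ℕ} :
      e.eval s = 0 → Exec d s t s' → Exec (.ite e c d) s (e.cost + 1 + t) s'
  | loopDone {e : Expr} {c : Cmd} {s : Mem} :
      e.eval s = 0 → Exec (.loop e c) s (e.cost + 1) s
  | loopStep {e : Expr} {c : Cmd} {s s' s'' : Mem} {t t' : ℕ} :
      e.eval s ≠ 0 → Exec c s t s' → Exec (.loop e c) s' t' s'' →
        Exec (.loop e c) s (e.cost + 1 + t + t') s''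

/-- The memory holding the input lists `ws`: the `k`-th list is in array `k` and its length in
register `k`; everything else is `0`. -/
def Mem.start (ws : List (List ℕ)) : Mem where
  reg k := (ws.getD k []).length
  arr k i := (ws.getD k []).getD i 0

/-- The output list: the first `reg 0` entries of array `0`. -/
def Mem.output (s : Mem) : List ℕ :=
  (List.range (s.reg 0)).map (s.arr 0)

/-- One program computes, for every index `i` with parameter `n = param i`, the list `out i` from
the number `n` and the lists `inp i`, in time (including the length of the output) polynomial in
`2 ^ n` plus the total length of the input. -/
def PolyTime {ι : Type} (param : ι → ℕ) (inp : ι → List (List ℕ)) (out : ι → List ℕ) : Prop :=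
  ∃ (c : Cmd) (q : Polynomial ℕ), ∀ i, ∃ (t : ℕ) (s : Mem),
    Exec c (Mem.start ([param i] :: inp i)) t s ∧ s.output = out i ∧
      t + (out i).length ≤ q.eval (2 ^ param i + (inp i).flatten.length)

/-! ### Search problems and reductions -/

/-- A search problem with a size parameter `n`, with encodings of its instances and solutions as
lists of natural numbers. -/
structure SearchProblem where
  Inst : ℕ → Type
  Sol : ℕ → Type
  IsSol : ∀ n, Inst n → Sol n → Prop
  encInst : ∀ n, Inst n → List ℕ
  encSol : ∀ n, Sol n → List ℕ

/-- A polynomial-time (in `2 ^ n`) reduction of the search problem `A` to the search problem `B`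
that preserves the parameter: `f` turns an instance `x` of `A` into an instance of `B`, and `g`
turns `x` together with any solution of `f x` into a solution of `x`. -/
structure IsPolyReduction (A B : SearchProblem) (f : ∀ n, A.Inst n → B.Inst n)
    (g : ∀ n, A.Inst n → B.Sol n → A.Sol n) : Prop where
  polyTime_f : PolyTime (fun i : Σ n, A.Inst n => i.1) (fun i => [A.encInst i.1 i.2])
    (fun i => B.encInst i.1 (f i.1 i.2))
  polyTime_g : PolyTime (fun i : Σ n, A.Inst n × B.Sol n => i.1)
    (fun i => [A.encInst i.1 i.2.1, B.encSol i.1 i.2.2])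
    (fun i => A.encSol i.1 (g i.1 i.2.1 i.2.2))
  correct : ∀ (n : ℕ) (x : A.Inst n) (y : B.Sol n), B.IsSol n (f n x) y → A.IsSol n x (g n x y)

/-- Polynomial-time (in `2 ^ n`) equivalence of search problems. -/
def PolyEquivalent (A B : SearchProblem) : Prop :=
  (∃ f g, IsPolyReduction A B f g) ∧ ∃ f g, IsPolyReduction B A f g

/-! ### Circuits over CNOT and T -/

/-- Labels `x` of the computational basis vectors `|x⟩` of `n` qubits. -/
abbrev Bits (n : ℕ) : Type := Fin n → ZMod 2

/-- Operators on `n` qubits in the computational basis. -/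
abbrev Operator (n : ℕ) : Type := Matrix (Bits n) (Bits n) ℂ

/-- The gate set on `n` qubits, where `P = T ^ 2` and `Z = T ^ 4`. -/
inductive Gate (n : ℕ) : Type
  | cnot (control target : Fin n) (h : control ≠ target)
  | T (q : Fin n)
  | P (q : Fin n)
  | Z (q : Fin n)

/-- The operator `|x⟩ ↦ exp (i π x_q / 4) |x⟩`. -/
def tMatrix {n : ℕ} (q : Fin n) : Operator n :=
  Matrix.diagonal fun x => Complex.exp (Complex.I * (Real.pi / 4) * ((x q).val : ℂ))

/-- The operator `|x⟩ ↦ |x'⟩`, where `x'` is `x` with its target bit replaced by the sum of the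
control bit and the target bit. -/
def cnotMatrix {n : ℕ} (control target : Fin n) : Operator n :=
  Matrix.of fun y x => if y = Function.update x target (x control + x target) then 1 else 0

/-- The unitary of a gate. -/
def Gate.unitary {n : ℕ} : Gate n → Operator n
  | .cnot c t _ => cnotMatrix c t
  | .T q => tMatrix q
  | .P q => tMatrix q ^ 2
  | .Z q => tMatrix q ^ 4

/-- Whether a gate is a `T` gate. -/
def Gate.isT {n : ℕ} : Gate n → Bool
  | .T _ => true
  | _ => false

/-- Whether a gate is a `CNOT` gate. -/
def Gate.isCnot {n : ℕ} : Gate n → Bool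
  | .cnot _ _ _ => true
  | _ => false

/-- A gate as three numbers. -/
def Gate.encode {n : ℕ} : Gate n → List ℕ
  | .cnot c t _ => [0, c, t]
  | .T q => [1, q, 0]
  | .P q => [2, q, 0]
  | .Z q => [3, q, 0]

/-- An `n`-qubit circuit: a list of gates; the head of the list is applied first. -/
abbrev Circuit (n : ℕ) : Type := List (Gate n)

/-- The unitary of a circuit. -/
def Circuit.unitary {n : ℕ} : Circuit n → Operator n
  | [] => 1
  | g :: C => Circuit.unitary C * g.unitary

/-- The number of `T` gates of a circuit. -/
def Circuit.tCount {n : ℕ} (C : Circuit n) : ℕ := C.countP Gate.isT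

/-- A circuit as a list of numbers. -/
def Circuit.encode {n : ℕ} (C : Circuit n) : List ℕ := C.flatMap Gate.encode

/-- `T`-count minimization: given a circuit, find an equivalent circuit (one with the same
unitary) with the least possible number of `T` gates. -/
def tCountMinimization : SearchProblem where
  Inst := Circuit
  Sol := Circuit
  IsSol _ C D := Circuit.unitary D = Circuit.unitary C ∧
    ∀ E, Circuit.unitary E = Circuit.unitary C → Circuit.tCount D ≤ Circuit.tCount E
  encInst _ C := Circuit.encode C
  encSol _ C := Circuit.encode C

/-! ### Punctured Reed-Muller codes -/

/-- The non-zero vectors of `𝔽₂ⁿ` in the order `(1,0,0,…,0), (0,1,0,…,0), (1,1,0,…,0), …`: the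
bits of the `j`-th one are the binary digits of `j + 1`, least significant first. -/
def nonzeroVec (n : ℕ) (j : Fin (2 ^ n - 1)) : Bits n :=
  fun i => if (j.val + 1).testBit i.val then 1 else 0

/-- Binary words of length `2 ^ n - 1`. -/
abbrev Word (n : ℕ) : Type := Fin (2 ^ n - 1) → ZMod 2

/-- A binary word as a list of numbers. -/
def Word.encode {n : ℕ} (w : Word n) : List ℕ := List.ofFn fun j => (w j).val

/-- The punctured Reed-Muller code of order `r` and length `2 ^ n - 1`: the evaluation vectors, on
the non-zero points of `𝔽₂ⁿ`, of the polynomials of degree at most `r` (only the zero polynomial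
if `r < 0`). -/
def puncturedRM (r : ℤ) (n : ℕ) : Set (Word n) :=
  {w | ∃ f : MvPolynomial (Fin n) (ZMod 2), (∀ m ∈ f.support, (m.degree : ℤ) ≤ r) ∧
    ∀ j, w j = MvPolynomial.eval (nonzeroVec n j) f}

/-- Minimum distance decoding for a family of binary codes of length `2 ^ n - 1`: given a word,
find a codeword at minimum Hamming distance from it. -/
def minDistDecoding (code : ∀ n, Set (Word n)) : SearchProblem where
  Inst := Word
  Sol := Word
  IsSol n x y := y ∈ code n ∧ ∀ z ∈ code n, hammingDist x y ≤ hammingDist x z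
  encInst _ w := Word.encode w
  encSol _ w := Word.encode w

/-! ### Phase polynomials -/

/-- Coefficient tuples of phase polynomials: elements of `(ℤ/8)^(2^n - 1)`. -/
abbrev Tuple (n : ℕ) : Type := Fin (2 ^ n - 1) → ZMod 8

/-- A coefficient tuple as a list of numbers. -/
def Tuple.encode {n : ℕ} (a : Tuple n) : List ℕ := List.ofFn fun j => (a j).val

/-- The number of odd coefficients. -/
def Tuple.oddCount {n : ℕ} (a : Tuple n) : ℕ :=
  (Finset.univ.filter fun j => Odd (a j).val).card

/-- The componentwise residue modulo `2`. -/
def Tuple.res {n : ℕ} (a : Tuple n) : Word n := fun j => ((a j).val : ZMod 2)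

/-- The componentwise inclusion of `{0, 1} = 𝔽₂` in `ℤ/8`. -/
def Word.lift {n : ℕ} (w : Word n) : Tuple n := fun j => ((w j).val : ZMod 8)

/-- The phase polynomial `P_a (x) = ∑_y a_y ι(y₁ x₁ ⊕ ⋯ ⊕ yₙ xₙ)`, summed over `y ≠ 0`. -/
def Tuple.phasePoly {n : ℕ} (a : Tuple n) (x : Bits n) : ZMod 8 :=
  ∑ j, a j * ((nonzeroVec n j ⬝ᵥ x).val : ZMod 8)

/-- The linear phase operator `|x⟩ ↦ exp (i π P_a (x) / 4) |x⟩`. -/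
def Tuple.phaseOperator {n : ℕ} (a : Tuple n) : Operator n :=
  Matrix.diagonal fun x => Complex.exp (Complex.I * (Real.pi / 4) * ((a.phasePoly x).val : ℂ))

/-- The tuple `a` implements the phase of the circuit `C`: the unitary of `C` is the linear phase
operator of `a` followed by a permutation that a circuit of `CNOT` gates performs. -/
def Implements {n : ℕ} (a : Tuple n) (C : Circuit n) : Prop :=
  ∃ L : Circuit n, (∀ g ∈ L, g.isCnot = true) ∧
    Circuit.unitary C = Circuit.unitary L * a.phaseOperator

end

end TCount

/-! Every gate sends `|x⟩` to a phase times a basis vector, and so does every circuit: its unitary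
is a monomial matrix, given by a map of the labels and a function `Bits n → ZMod 8`. The unitary
determines both (`monomialMatrix_inj`), and only the `CNOT` gates move the labels. Hence `a`
implements `C` exactly when `P_a` is the phase function of `C` (`implements_iff`), and equivalent
circuits differ only in how they realize one phase function.

Circuits and tuples translate into each other. While a circuit runs, each qubit carries a nonzero
linear form in the input; a diagonal gate adds its weight 0, 1, 2 or 4 to the coefficient of the
form on its qubit, so only `T` gates change parities and the odd coefficients number at most the `T`
gates. Conversely a term `a_y (y · x)` is realized by computing `y · x` on one qubit with `CNOT`
gates, applying `T`, `P`, `Z` by the binary digits of `a_y`, and uncomputing; this costs one `T`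
gate if `a_y` is odd and none otherwise. The least `T`-count is therefore the least number of odd
coefficients among the tuples with the same phase polynomial.

The core is that the residues modulo 2 of the tuples with `P_a = 0` form exactly the code of order
`n - 4`. If `P_a = 0`, its third differences give `4 ∑ a_y y_i y_k y_l = 0` modulo 8, so the residue
is orthogonal to the monomials of degree 1 to 3; a suitable value at the origin adds orthogonality
to constants, and interpolation bounds the degree by `n - 4` (`Tuple.res_mem_puncturedRM`).
Conversely a codeword is orthogonal to these monomials because a polynomial of degree below `n` sums
to zero over the cube. With `s = |Z ∩ X|`, the congruence `s mod 2 - s² = 4 (C(s,2) + C(s,3))`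
modulo 8 turns this orthogonality into the statement that the phase of the codeword equals a sum of
squares `s²`; the negative of that sum is the phase polynomial of a tuple with even coefficients
supported on weights 1 and 2 (`Word.res_corr`, `Word.phasePoly_lift_add_corr`). Minimizing the odd
coefficients is thus finding the codeword nearest to a residue.

For the time bounds, `Ctx.Comp` expresses polynomial-time computability relative to lists already in
memory. It is closed under composition, concatenation, case distinction and bounded loops, and the
maps above are assembled from these operations. -/

namespace TCount

section

/-! ### Lists in memory and contexts of computations -/

/-- The memories `s` and `s'` have the same first `d` registers and arrays. -/
def Agree (d : ℕ) (s s' : Mem) : Prop :=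
  ∀ k < d, s'.reg k = s.reg k ∧ s'.arr k = s.arr k

/-- Slot `k` of the memory (the register `k` and the array `k`) holds the list `l`. -/
def HasList (s : Mem) (k : ℕ) (l : List ℕ) : Prop :=
  s.reg k = l.length ∧ ∀ i < l.length, s.arr k i = l.getD i 0

theorem Agree.trans {d : ℕ} {s s' s'' : Mem} (h : Agree d s s') (h' : Agree d s' s'') :
    Agree d s s'' := fun k hk =>
  ⟨(h' k hk).1.trans (h k hk).1, (h' k hk).2.trans (h k hk).2⟩

theorem Agree.mono {d d' : ℕ} {s s' : Mem} (h : Agree d s s') (hd : d' ≤ d) : Agree d' s s' :=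
  fun k hk => h k (hk.trans_le hd)

theorem Agree.hasList {d k : ℕ} {s s' : Mem} {l : List ℕ} (h : Agree d s s') (hk : k < d)
    (hl : HasList s k l) : HasList s' k l := by
  refine ⟨(h k hk).1.trans hl.1, fun i hi => ?_⟩
  rw [(h k hk).2]
  exact hl.2 i hi

@[simp] theorem Mem.setReg_reg (s : Mem) (r v k : ℕ) :
    (s.setReg r v).reg k = if k = r then v else s.reg k := by
  simp [Mem.setReg, Function.update_apply]

@[simp] theorem Mem.setReg_arr (s : Mem) (r v : ℕ) : (s.setReg r v).arr = s.arr := rfl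

@[simp] theorem Mem.setArr_reg (s : Mem) (a i v : ℕ) : (s.setArr a i v).reg = s.reg := rfl

theorem Mem.setArr_arr (s : Mem) (a i v k : ℕ) :
    (s.setArr a i v).arr k = if k = a then Function.update (s.arr a) i v else s.arr k := by
  simp [Mem.setArr, Function.update_apply]

/-- `f` is bounded by a polynomial in `m`. -/
def PolyBound {ι : Type} (m f : ι → ℕ) : Prop :=
  ∃ q : Polynomial ℕ, ∀ i, f i ≤ q.eval (m i)

/-! ### Arithmetic of polynomial bounds. -/

namespace PolyBound

variable {ι κ : Type} {m f g : ι → ℕ}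

theorem mono (hg : PolyBound m g) (h : ∀ i, f i ≤ g i) : PolyBound m f :=
  hg.imp fun _ hq i => (h i).trans (hq i)

theorem const (m : ι → ℕ) (c : ℕ) : PolyBound m fun _ => c :=
  ⟨Polynomial.C c, fun i => by simp⟩

theorem self (m : ι → ℕ) : PolyBound m m := ⟨Polynomial.X, fun i => by simp⟩

theorem add (hf : PolyBound m f) (hg : PolyBound m g) : PolyBound m fun i => f i + g i := by
  obtain ⟨p, hp⟩ := hf
  obtain ⟨q, hq⟩ := hg
  exact ⟨p + q, fun i => by simpa using add_le_add (hp i) (hq i)⟩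

theorem mul (hf : PolyBound m f) (hg : PolyBound m g) : PolyBound m fun i => f i * g i := by
  obtain ⟨p, hp⟩ := hf
  obtain ⟨q, hq⟩ := hg
  exact ⟨p * q, fun i => by simpa using Nat.mul_le_mul (hp i) (hq i)⟩

theorem comp (hf : PolyBound m f) (φ : κ → ι) : PolyBound (fun i => m (φ i)) fun i => f (φ i) :=
  hf.imp fun _ hq i => hq (φ i)

end PolyBound

/-- A context: for each index, a size and a condition on the first `depth` slots of the memory. -/
structure Ctx (ι : Type) where
  depth : ℕ
  size : ι → ℕ
  Holds : ι → Mem → Prop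
  agree : ∀ i s s', Agree depth s s' → Holds i s → Holds i s'
  exists_holds : ∀ i, ∃ s, Holds i s

/-- The context with one more slot, which holds the list `h`. -/
def Ctx.ext {ι : Type} (Γ : Ctx ι) (h : ι → List ℕ) : Ctx ι where
  depth := Γ.depth + 1
  size := Γ.size
  Holds i s := Γ.Holds i s ∧ HasList s Γ.depth (h i)
  agree i s s' hs h := ⟨Γ.agree i s s' (hs.mono (Nat.le_succ _)) h.1,
    hs.hasList (Nat.lt_succ_self _) h.2⟩
  exists_holds i := by
    obtain ⟨s, hs⟩ := Γ.exists_holds i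
    refine ⟨⟨Function.update s.reg Γ.depth (h i).length,
      Function.update s.arr Γ.depth fun j => (h i).getD j 0⟩,
      Γ.agree i s _ (fun k hk => by simp [hk.ne]) hs, by simp, by simp⟩

/-- The context reindexed by `φ`. -/
def Ctx.pull {ι κ : Type} (Γ : Ctx ι) (φ : κ → ι) : Ctx κ where
  depth := Γ.depth
  size i := Γ.size (φ i)
  Holds i s := Γ.Holds (φ i) s
  agree i s s' hs h := Γ.agree (φ i) s s' hs h
  exists_holds i := Γ.exists_holds (φ i)

/-- In the context `Γ`, slot `k` holds the list `l`. -/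
def Ctx.Var {ι : Type} (Γ : Ctx ι) (k : ℕ) (l : ι → List ℕ) : Prop :=
  k < Γ.depth ∧ ∀ i s, Γ.Holds i s → HasList s k (l i)

/-- In the context `Γ`, the number `v` is the value of an expression. -/
def Ctx.Scalar {ι : Type} (Γ : Ctx ι) (v : ι → ℕ) : Prop :=
  ∃ e : Expr, ∀ i s, Γ.Holds i s → e.eval s = v i

/-- In the context `Γ`, a program computes the list `out` in polynomial time, stores it in the
first free slot and preserves the slots of the context. -/
def Ctx.Comp {ι : Type} (Γ : Ctx ι) (out : ι → List ℕ) : Prop :=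
  ∃ (c : Cmd) (q : Polynomial ℕ), ∀ i s, Γ.Holds i s → ∃ (t : ℕ) (s' : Mem),
    Exec c s t s' ∧ Agree Γ.depth s s' ∧ HasList s' Γ.depth (out i) ∧
      t + (out i).length ≤ q.eval (Γ.size i)

variable {ι κ : Type} {Γ : Ctx ι}

/-! ### Stored lists and scalar expressions in a context. -/

namespace Ctx

theorem Var.ext {k : ℕ} {l : ι → List ℕ} (h : Γ.Var k l) (g : ι → List ℕ) :
    (Γ.ext g).Var k l := ⟨Nat.lt_succ_of_lt h.1, fun i s hs => h.2 i s hs.1⟩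

theorem Var.pull {k : ℕ} {l : ι → List ℕ} (h : Γ.Var k l) (φ : κ → ι) :
    (Γ.pull φ).Var k fun i => l (φ i) := ⟨h.1, fun i s hs => h.2 (φ i) s hs⟩

theorem Var.last (Γ : Ctx ι) (g : ι → List ℕ) : (Γ.ext g).Var Γ.depth g :=
  ⟨Nat.lt_succ_self _, fun _ _ hs => hs.2⟩

namespace Scalar

variable {v w : ι → ℕ}

theorem ext (h : Γ.Scalar v) (g : ι → List ℕ) : (Γ.ext g).Scalar v :=
  h.imp fun _ he i s hs => he i s hs.1

theorem pull (h : Γ.Scalar v) (φ : κ → ι) : (Γ.pull φ).Scalar fun i => v (φ i) :=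
  h.imp fun _ he i s hs => he (φ i) s hs

theorem const (Γ : Ctx ι) (c : ℕ) : Γ.Scalar fun _ => c := ⟨.num c, fun _ _ _ => rfl⟩

theorem add (hv : Γ.Scalar v) (hw : Γ.Scalar w) : Γ.Scalar fun i => v i + w i := by
  obtain ⟨e, he⟩ := hv
  obtain ⟨f, hf⟩ := hw
  exact ⟨.plus e f, fun i s hs => by simp [Expr.eval, he i s hs, hf i s hs]⟩

theorem sub (hv : Γ.Scalar v) (hw : Γ.Scalar w) : Γ.Scalar fun i => v i - w i := by
  obtain ⟨e, he⟩ := hv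
  obtain ⟨f, hf⟩ := hw
  exact ⟨.minus e f, fun i s hs => by simp [Expr.eval, he i s hs, hf i s hs]⟩

theorem half (hv : Γ.Scalar v) : Γ.Scalar fun i => v i / 2 := by
  obtain ⟨e, he⟩ := hv
  exact ⟨.half e, fun i s hs => by simp [Expr.eval, he i s hs]⟩

theorem congr (hv : Γ.Scalar v) (h : ∀ i, v i = w i) : Γ.Scalar w :=
  (funext h : v = w) ▸ hv

/-- Halving followed by doubling rounds down to a multiple of 2; the difference is the remainder.
The remainder modulo 8 is obtained in the same way from three halvings. -/
theorem mod_two (hv : Γ.Scalar v) : Γ.Scalar fun i => v i % 2 :=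
  (hv.sub (hv.half.add hv.half)).congr fun i => by omega

theorem mod_eight (hv : Γ.Scalar v) : Γ.Scalar fun i => v i % 8 := by
  have h := hv.half.half.half
  have h2 := h.add h
  have h4 := h2.add h2
  exact (hv.sub (h4.add h4)).congr fun i => by omega

theorem mul_three (hv : Γ.Scalar v) : Γ.Scalar fun i => 3 * v i :=
  ((hv.add hv).add hv).congr fun i => by omega

theorem mul_seven (hv : Γ.Scalar v) : Γ.Scalar fun i => 7 * v i := by
  have h := hv.mul_three
  exact ((h.add h).add hv).congr fun i => by omega

end Scalar

theorem Var.length {k : ℕ} {l : ι → List ℕ} (h : Γ.Var k l) :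
    Γ.Scalar fun i => (l i).length := ⟨.var k, fun i s hs => (h.2 i s hs).1⟩

/-- The bound on the index is essential: `HasList` says nothing about array entries beyond the end
of the list, where earlier computations may have left values. -/
theorem Var.get {k : ℕ} {l : ι → List ℕ} {v : ι → ℕ} (h : Γ.Var k l) (hv : Γ.Scalar v)
    (hlt : ∀ i, v i < (l i).length) : Γ.Scalar fun i => (l i).getD (v i) 0 := by
  obtain ⟨e, he⟩ := hv
  exact ⟨.read k e, fun i s hs => by
    simp only [Expr.eval, he i s hs]; exact (h.2 i s hs).2 _ (hlt i)⟩

theorem Var.scalar {k : ℕ} {v : ι → ℕ} (h : Γ.Var k fun i => [v i]) : Γ.Scalar v :=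
  (h.get (.const Γ 0) (by simp)).congr (by simp)

theorem Scalar.last (Γ : Ctx ι) (v : ι → ℕ) : (Γ.ext fun i => [v i]).Scalar v :=
  (Var.last Γ fun i => [v i]).scalar

end Ctx

/-! ### Programs -/

theorem exec_loop {e : Expr} {c : Cmd} (I : ℕ → Mem → Prop) {N T : ℕ}
    (hpos : ∀ k < N, ∀ s, I k s → e.eval s ≠ 0) (hzero : ∀ s, I N s → e.eval s = 0)
    (hstep : ∀ k < N, ∀ s, I k s → ∃ t s', Exec c s t s' ∧ t ≤ T ∧ I (k + 1) s')
    {s : Mem} (hs : I 0 s) :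
    ∃ t s', Exec (.loop e c) s t s' ∧ t ≤ (N + 1) * (e.cost + 1) + N * T ∧ I N s' := by
  suffices H : ∀ j ≤ N, ∀ s, I (N - j) s → ∃ t s', Exec (.loop e c) s t s' ∧
      t ≤ (j + 1) * (e.cost + 1) + j * T ∧ I N s' from H N le_rfl s (by simpa using hs)
  intro j
  induction j with
  -- The induction is on the number `j` of passes that remain.
  | zero => exact fun _ s hs => ⟨_, s, .loopDone (hzero s hs), by simp, hs⟩
  | succ j ih =>
    intro hj s hs
    obtain ⟨t, s', h, ht, hI⟩ := hstep (N - (j + 1)) (by omega) s hs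
    rw [show N - (j + 1) + 1 = N - j by omega] at hI
    obtain ⟨t', s'', h', ht', hI'⟩ := ih (by omega) s' hI
    refine ⟨_, s'', .loopStep (hpos _ (by omega) s hs) h h', ?_, hI'⟩
    nlinarith

/-- Append the list in slot `a` to the list in slot `b`, with counter `r`. -/
def appendCmd (a b r : ℕ) : Cmd :=
  .seq (.assign r (.num 0)) <| .seq
    (.loop (.minus (.var a) (.var r))
      (.seq (.write b (.plus (.var b) (.var r)) (.read a (.var r)))
        (.assign r (.plus (.var r) (.num 1)))))
    (.assign b (.plus (.var b) (.var a)))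

theorem exec_appendCmd {a b r : ℕ} (hab : a ≠ b) (har : a ≠ r) (hbr : b ≠ r) {s : Mem}
    {la lb : List ℕ} (ha : HasList s a la) (hb : HasList s b lb) :
    ∃ t s', Exec (appendCmd a b r) s t s' ∧ t ≤ 20 * (la.length + 1) ∧
      HasList s' b (lb ++ la) ∧ (∀ k, k ≠ b → k ≠ r → s'.reg k = s.reg k) ∧
      ∀ k, k ≠ b → s'.arr k = s.arr k := by
  let I : ℕ → Mem → Prop := fun k s' => s'.reg r = k ∧ (∀ i, i ≠ r → s'.reg i = s.reg i) ∧
    (∀ i, i ≠ b → s'.arr i = s.arr i) ∧ ∀ i < lb.length + k, s'.arr b i = (lb ++ la).getD i 0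
  -- One pass costs 10 and one test 4. With 12 allowed per pass, the loop and the two outer
  -- assignments stay below 20 steps per element plus 20.
  obtain ⟨t, s', h, ht, hr, hreg, harr, hlist⟩ := exec_loop (e := .minus (.var a) (.var r))
    (c := .seq (.write b (.plus (.var b) (.var r)) (.read a (.var r)))
        (.assign r (.plus (.var r) (.num 1)))) I (N := la.length) (T := 20 - 8)
    (s := s.setReg r 0)
    (by
      rintro k hk s' ⟨h1, h2, -⟩
      simp only [Expr.eval, h1, h2 a har, ha.1]
      omega)
    (by
      rintro s' ⟨h1, h2, -⟩
      simp only [Expr.eval, h1, h2 a har, ha.1]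
      omega)
    (by
      rintro k hk s' ⟨h1, h2, h3, h4⟩
      refine ⟨_, _, .seq (.write _ _ _ _) (.assign _ _ _), ?_, ?_⟩
      · simp [Expr.cost]
      · refine ⟨?_, ?_, ?_, ?_⟩
        · simp [Expr.eval, h1]
        · intro i hi
          simp [hi, h2 i hi]
        · intro i hi
          simp [Mem.setArr_arr, hi, h3 i hi]
        · intro i hi
          simp only [Mem.setReg_arr, Mem.setArr_arr, if_true, Function.update_apply, Expr.eval, h1,
            h2 b hbr, hb.1, h3 a hab]
          split_ifs with hik
          · rw [ha.2 k hk, hik, List.getD_append_right _ _ _ _ (by omega)]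
            simp
          · exact h4 i (by omega))
    (by
      refine ⟨by simp, fun i hi => by simp [hi], fun i hi => rfl, fun i hi => ?_⟩
      rw [Nat.add_zero] at hi
      rw [Mem.setReg_arr, hb.2 i hi, List.getD_append _ _ _ _ hi])
  refine ⟨_, _, .seq (.assign _ _ _) (.seq h (.assign _ _ _)), ?_, ⟨?_, ?_⟩, ?_, ?_⟩
  · simp only [Expr.cost] at ht ⊢
    omega
  · simp [Expr.eval, hreg b hbr, hreg a har, ha.1, hb.1]
  · intro i hi
    rw [List.length_append] at hi
    exact hlist i hi
  · intro k hk hkr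
    simp [hk, hreg k hkr]
  · intro k hk
    simpa using harr k hk

/-- Copy the list in slot `a` to slot `b`, with counter `r`. -/
def moveCmd (a b r : ℕ) : Cmd := .seq (.assign b (.num 0)) (appendCmd a b r)

theorem exec_moveCmd {a b r : ℕ} (hab : a ≠ b) (har : a ≠ r) (hbr : b ≠ r) {s : Mem}
    {la : List ℕ} (ha : HasList s a la) :
    ∃ t s', Exec (moveCmd a b r) s t s' ∧ t ≤ 20 * (la.length + 1) + 2 ∧
      HasList s' b la ∧ (∀ k, k ≠ b → k ≠ r → s'.reg k = s.reg k) ∧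
      ∀ k, k ≠ b → s'.arr k = s.arr k := by
  obtain ⟨t, s', h, ht, hl, hreg, harr⟩ := exec_appendCmd hab har hbr (s := s.setReg b 0)
    (la := la) (lb := []) ⟨by simp [hab, ha.1], ha.2⟩ ⟨by simp, by simp⟩
  refine ⟨_, s', .seq (.assign _ _ _) h, by simp [Expr.cost]; omega, hl, ?_, harr⟩
  intro k hk hkr
  simp [hreg k hk hkr, hk]

/-! ### Closure properties of polynomial-time computations. -/

namespace Ctx

variable {out f g : ι → List ℕ}

theorem Comp.congr (h : Γ.Comp f) (hfg : ∀ i, f i = g i) : Γ.Comp g :=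
  (funext hfg : f = g) ▸ h

/-- The bound comes from an actual run of the program, so some memory must satisfy the context; this
is the purpose of `exists_holds`. -/
theorem Comp.length_polyBound (h : Γ.Comp out) :
    PolyBound Γ.size fun i => (out i).length := by
  obtain ⟨c, q, h⟩ := h
  refine ⟨q, fun i => ?_⟩
  obtain ⟨s, hs⟩ := Γ.exists_holds i
  obtain ⟨t, s', -, -, -, ht⟩ := h i s hs
  exact le_of_add_le_right ht

theorem Comp.of_exec {b : ι → ℕ} (c : Cmd) (hb : PolyBound Γ.size b)
    (h : ∀ i s, Γ.Holds i s → ∃ (t : ℕ) (s' : Mem), Exec c s t s' ∧ Agree Γ.depth s s' ∧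
      HasList s' Γ.depth (out i) ∧ t + (out i).length ≤ b i) : Γ.Comp out := by
  obtain ⟨q, hq⟩ := hb
  refine ⟨c, q, fun i s hs => ?_⟩
  obtain ⟨t, s', h1, h2, h3, h4⟩ := h i s hs
  exact ⟨t, s', h1, h2, h3, h4.trans (hq i)⟩

theorem Comp.exists_exec (h : Γ.Comp out) : ∃ (b : ι → ℕ) (c : Cmd), PolyBound Γ.size b ∧
    ∀ i s, Γ.Holds i s → ∃ (t : ℕ) (s' : Mem), Exec c s t s' ∧ Agree Γ.depth s s' ∧
      HasList s' Γ.depth (out i) ∧ t + (out i).length ≤ b i := by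
  obtain ⟨c, q, h⟩ := h
  exact ⟨fun i => q.eval (Γ.size i), c, ⟨q, fun _ => le_rfl⟩, h⟩

theorem Comp.nil (Γ : Ctx ι) : Γ.Comp fun _ => [] :=
  .of_exec (.assign Γ.depth (.num 0)) (.const _ 2) fun i s hs =>
    ⟨_, _, .assign _ _ _, fun k hk => by simp [hk.ne], ⟨by simp [Expr.eval], by simp⟩,
      by simp [Expr.cost]⟩

theorem Scalar.comp {v : ι → ℕ} (h : Γ.Scalar v) : Γ.Comp fun i => [v i] := by
  obtain ⟨e, he⟩ := h
  refine .of_exec (.seq (.write Γ.depth (.num 0) e) (.assign Γ.depth (.num 1)))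
    (.const _ (e.cost + 5)) fun i s hs =>
    ⟨_, _, .seq (.write _ _ _ _) (.assign _ _ _), ?_, ⟨?_, ?_⟩, ?_⟩
  · exact fun k hk => by simp [hk.ne, Mem.setArr_arr]
  · simp [Expr.eval]
  · simp [Expr.eval, Mem.setArr_arr, he i s hs]
  · simp only [Expr.cost, List.length_singleton]
    omega

/-- A context puts no bound on the lengths of the lists it holds, so copying one in polynomial time
needs a separate length bound. -/
theorem Var.comp {k : ℕ} (h : Γ.Var k out) (hb : PolyBound Γ.size fun i => (out i).length) :
    Γ.Comp out := by
  refine .of_exec (b := fun i => 21 * (out i).length + 22) (moveCmd k Γ.depth (Γ.depth + 1))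
    (((PolyBound.const _ 21).mul hb).add (.const _ 22)) fun i s hs => ?_
  have hk := h.1
  obtain ⟨t, s', h1, h2, h3, h4, h5⟩ := exec_moveCmd (a := k) (b := Γ.depth) (r := Γ.depth + 1)
    hk.ne (by omega) (by omega) (h.2 i s hs)
  exact ⟨t, s', h1, fun j hj => ⟨h4 j (by omega) (by omega), h5 j hj.ne⟩, h3, by omega⟩

/-- The intermediate list occupies the first free slot, so the result appears one slot too high and
is moved down over it. -/
theorem Comp.bind (hf : Γ.Comp f) (hg : (Γ.ext f).Comp g) : Γ.Comp g := by
  obtain ⟨bf, cf, hbf, hf⟩ := hf.exists_exec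
  obtain ⟨bg, cg, hbg, hg⟩ := hg.exists_exec
  refine .of_exec (b := fun i => bf i + (21 * bg i + 22))
    (.seq cf (.seq cg (moveCmd (Γ.depth + 1) Γ.depth (Γ.depth + 2))))
    (hbf.add (((PolyBound.const _ 21).mul hbg).add (.const _ 22))) fun i s hs => ?_
  obtain ⟨t, s1, h1, h2, h3, h4⟩ := hf i s hs
  obtain ⟨t', s2, h1', h2', h3', h4'⟩ := hg i s1 ⟨Γ.agree i s s1 h2 hs, h3⟩
  obtain ⟨t'', s3, k1, k2, k3, k4, k5⟩ := exec_moveCmd (a := Γ.depth + 1) (b := Γ.depth)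
    (r := Γ.depth + 2) (by omega) (by omega) (by omega) h3'
  refine ⟨_, s3, .seq h1 (.seq h1' k1), (h2.trans (h2'.mono (Nat.le_succ _))).trans fun j hj => ?_,
    k3, by omega⟩
  exact ⟨k4 j (by omega) (by omega), k5 j hj.ne⟩

theorem Comp.append_ext (hf : Γ.Comp f) (hg : (Γ.ext f).Comp g) :
    Γ.Comp fun i => f i ++ g i := by
  obtain ⟨bf, cf, hbf, hf⟩ := hf.exists_exec
  obtain ⟨bg, cg, hbg, hg⟩ := hg.exists_exec
  refine .of_exec (b := fun i => bf i + (21 * bg i + 22))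
    (.seq cf (.seq cg (appendCmd (Γ.depth + 1) Γ.depth (Γ.depth + 2))))
    (hbf.add (((PolyBound.const _ 21).mul hbg).add (.const _ 22))) fun i s hs => ?_
  obtain ⟨t, s1, h1, h2, h3, h4⟩ := hf i s hs
  obtain ⟨t', s2, h1', h2', h3', h4'⟩ := hg i s1 ⟨Γ.agree i s s1 h2 hs, h3⟩
  obtain ⟨t'', s3, k1, k2, k3, k4, k5⟩ := exec_appendCmd (a := Γ.depth + 1) (b := Γ.depth)
    (r := Γ.depth + 2) (by omega) (by omega) (by omega) h3'
    (h2'.hasList (Nat.lt_succ_self Γ.depth) h3)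
  refine ⟨_, s3, .seq h1 (.seq h1' k1), (h2.trans (h2'.mono (Nat.le_succ _))).trans fun j hj => ?_,
    k3, by simp only [List.length_append]; omega⟩
  exact ⟨k4 j (by omega) (by omega), k5 j hj.ne⟩

/-- Conditions enter programs as the vanishing of a number. With truncated subtraction, `u - v = 0`
means `u ≤ v`, `(u - v) + (v - u) = 0` means `u = v`, and a sum of tests is a conjunction. -/
theorem Scalar.ite {v : ι → ℕ} {p : ι → Prop} [DecidablePred p] (hv : Γ.Scalar v)
    (hf : Γ.Comp f) (hg : Γ.Comp g) (hp : ∀ i, p i ↔ v i = 0) :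
    Γ.Comp fun i => if p i then f i else g i := by
  obtain ⟨e, he⟩ := hv
  obtain ⟨bf, cf, hbf, hf⟩ := hf.exists_exec
  obtain ⟨bg, cg, hbg, hg⟩ := hg.exists_exec
  refine .of_exec (b := fun i => bf i + bg i + (e.cost + 1)) (.ite e cg cf)
    ((hbf.add hbg).add (.const _ _)) fun i s hs => ?_
  have hes := he i s hs
  by_cases h0 : v i = 0
  · obtain ⟨t, s', h1, h2, h3, h4⟩ := hf i s hs
    rw [if_pos ((hp i).2 h0)]
    exact ⟨_, s', .iteFalse (hes.trans h0) h1, h2, h3, by omega⟩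
  · obtain ⟨t, s', h1, h2, h3, h4⟩ := hg i s hs
    rw [if_neg (mt (hp i).1 h0)]
    exact ⟨_, s', .iteTrue (by rwa [hes]) h1, h2, h3, by omega⟩

/-- The indices of the passes of a loop with `N` passes. -/
abbrev Pass (N : ι → ℕ) : Type := {p : ι × ℕ // p.2 < N p.1}

/-- The context of the body of a loop: the current state and the number of the pass are added. -/
abbrev inLoop (Γ : Ctx ι) (N : ι → ℕ) (st : ι → ℕ → List ℕ) : Ctx (Pass N) :=
  ((Γ.pull fun p : Pass N => p.1.1).ext fun p => st p.1.1 p.1.2).ext fun p => [p.1.2]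

variable {N : ι → ℕ} {st : ι → ℕ → List ℕ}

theorem Scalar.inLoop {v : ι → ℕ} (h : Γ.Scalar v) (N : ι → ℕ) (st : ι → ℕ → List ℕ) :
    (Γ.inLoop N st).Scalar fun p => v p.1.1 := ((h.pull _).ext _).ext _

theorem Var.inLoop {k : ℕ} {l : ι → List ℕ} (h : Γ.Var k l) (N : ι → ℕ) (st : ι → ℕ → List ℕ) :
    (Γ.inLoop N st).Var k fun p => l p.1.1 := ((h.pull _).ext _).ext _

theorem Scalar.pass (Γ : Ctx ι) (N : ι → ℕ) (st : ι → ℕ → List ℕ) :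
    (Γ.inLoop N st).Scalar fun p => p.1.2 := .last _ _

theorem Var.state (Γ : Ctx ι) (N : ι → ℕ) (st : ι → ℕ → List ℕ) :
    (Γ.inLoop N st).Var Γ.depth fun p => st p.1.1 p.1.2 := (Var.last _ _).ext _

/-- The time and output of every pass are bounded by one polynomial in the size of the outer
context, not in the length of the current state. The bounds of the passes therefore add up and do
not compound. -/
theorem Comp.loop (hN : Γ.Scalar N) (hB : PolyBound Γ.size N) (h0 : Γ.Comp fun i => st i 0)
    (hs : (Γ.inLoop N st).Comp fun p => st p.1.1 (p.1.2 + 1)) :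
    Γ.Comp fun i => st i (N i) := by
  obtain ⟨e, he⟩ := hN
  obtain ⟨b0, c0, hb0, h0⟩ := h0.exists_exec
  obtain ⟨c, q, hs⟩ := hs
  set d := Γ.depth with hd
  have hq : PolyBound Γ.size fun i => q.eval (Γ.size i) := ⟨q, fun _ => le_rfl⟩
  refine .of_exec (b := fun i => b0 i + b0 i + 10 + (N i + 1) * (e.cost + 5) +
      (N i + 1) * (22 * q.eval (Γ.size i) + 40))
    (.seq c0 <| .seq (.write (d + 1) (.num 0) (.num 0)) <| .seq (.assign (d + 1) (.num 1)) <|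
      .loop (.minus e (.read (d + 1) (.num 0)))
        (.seq c (.seq (moveCmd (d + 2) d (d + 3))
          (.write (d + 1) (.num 0) (.plus (.read (d + 1) (.num 0)) (.num 1))))))
    ((((hb0.add hb0).add (.const _ _)).add ((hB.add (.const _ 1)).mul (.const _ _))).add
      ((hB.add (.const _ 1)).mul (((PolyBound.const _ 22).mul hq).add (.const _ _)))) ?_
  intro i s hsi
  obtain ⟨t0, s0, k1, k2, k3, k4⟩ := h0 i s hsi
  -- Slot `d` holds the state and slot `d + 1` the pass number. The body writes its output to slot
  -- `d + 2`, from where it is copied back. A state was produced either by the initial program or by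
  -- one pass, which gives the length bound in the last conjunct.
  let I : ℕ → Mem → Prop := fun k s' => Agree d s s' ∧ HasList s' d (st i k) ∧
    HasList s' (d + 1) [k] ∧ (st i k).length ≤ b0 i + q.eval (Γ.size i)
  have hread : ∀ k s', I k s' → (Expr.minus e (.read (d + 1) (.num 0))).eval s' = N i - k := by
    rintro k s' ⟨h1, -, h3, -⟩
    simp only [Expr.eval, he i s' (Γ.agree i s s' h1 hsi)]
    rw [h3.2 0 (by simp)]
    simp
  obtain ⟨t, s', h, ht, hI⟩ := exec_loop (e := .minus e (.read (d + 1) (.num 0)))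
    (c := .seq c (.seq (moveCmd (d + 2) d (d + 3))
          (.write (d + 1) (.num 0) (.plus (.read (d + 1) (.num 0)) (.num 1))))) I (N := N i)
    (T := 21 * q.eval (Γ.size i) + 40) (s := (s0.setArr (d + 1) 0 0).setReg (d + 1) 1)
    (fun k hk s' hI => by rw [hread k s' hI]; omega)
    (fun s' hI => by rw [hread _ s' hI]; omega)
    (by
      rintro k hk s' ⟨h1, h2, h3, -⟩
      obtain ⟨t1, s1, l1, l2, l3, l4⟩ := hs ⟨(i, k), hk⟩ s' ⟨⟨Γ.agree i s s' h1 hsi, h2⟩, h3⟩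
      obtain ⟨t2, s2, m1, m2, m3, m4, m5⟩ := exec_moveCmd (a := d + 2) (b := d) (r := d + 3)
        (by omega) (by omega) (by omega) l3
      have h3' := l2.hasList (Nat.lt_succ_self (d + 1)) h3
      have l4' : t1 + (st i (k + 1)).length ≤ q.eval (Γ.size i) := l4
      refine ⟨_, _, .seq l1 (.seq m1 (.write _ _ _ _)), ?_, ?_, ?_, ?_, ?_⟩
      · simp only [Expr.cost] at *
        omega
      · refine (h1.trans (l2.mono (by simp [inLoop, Ctx.ext, Ctx.pull, d]; omega))).trans
          fun j hj => ?_
        refine ⟨by simp [m4 j (by omega) (by omega)], ?_⟩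
        rw [Mem.setArr_arr, if_neg (by omega), m5 j (by omega)]
      · refine ⟨m3.1, fun j hj => ?_⟩
        rw [Mem.setArr_arr, if_neg (by omega)]
        exact m3.2 j hj
      · refine ⟨?_, fun j hj => ?_⟩
        · rw [Mem.setArr_reg, m4 _ (by omega) (by omega)]
          exact h3'.1
        · obtain rfl : j = 0 := by simpa using hj
          simp only [Mem.setArr_arr, if_true, Expr.eval, m5 (d + 1) (by omega)]
          rw [h3'.2 0 (by simp)]
          simp
      · omega)
    (by
      refine ⟨k2.trans fun j hj => ?_, ⟨?_, fun j hj => ?_⟩, ⟨by simp, fun j hj => ?_⟩, by omega⟩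
      · have hj' : j ≠ d + 1 := by omega
        simp [Mem.setArr_arr, hj']
      · simpa using k3.1
      · simpa [Mem.setArr_arr] using k3.2 j hj
      · obtain rfl : j = 0 := by simpa using hj
        simp [Mem.setArr_arr])
  obtain ⟨hI1, hI2, -, hI4⟩ := hI
  refine ⟨_, s', .seq k1 (.seq (.write _ _ _ _) (.seq (.assign _ _ _) h)), hI1, hI2, ?_⟩
  simp only [Expr.cost] at ht ⊢
  nlinarith

/-- The quantifier over `h` expresses that the second program ignores the slot where the first list
is kept. -/
theorem Comp.append (hf : Γ.Comp f) (hg : ∀ h, (Γ.ext h).Comp g) : Γ.Comp fun i => f i ++ g i :=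
  hf.append_ext (hg f)

/-- In the loop that concatenates the pieces, each pass copies the whole accumulated list, so the
length of that list must be bounded uniformly over the passes. -/
theorem flatMap_length_polyBound {g : ι → ℕ → List ℕ} (hB : PolyBound Γ.size N)
    (hg : PolyBound (fun p : Pass N => Γ.size p.1.1) fun p => (g p.1.1 p.1.2).length) :
    PolyBound (fun p : Pass N => Γ.size p.1.1) fun p =>
      ((List.range p.1.2).flatMap (g p.1.1)).length := by
  obtain ⟨q, hq⟩ := hg
  refine ((hB.comp fun p : Pass N => p.1.1).mul
    (⟨q, fun _ => le_rfl⟩ : PolyBound _ fun p : Pass N => q.eval (Γ.size p.1.1))).mono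
    fun ⟨⟨i, k⟩, hk⟩ => ?_
  dsimp only at hk ⊢
  rw [List.length_flatMap]
  refine (List.sum_le_card_nsmul _ (q.eval (Γ.size i)) ?_).trans ?_
  · intro x hx
    obtain ⟨j, hj, rfl⟩ := List.mem_map.1 hx
    exact hq ⟨(i, j), (List.mem_range.1 hj).trans hk⟩
  · simp only [List.length_map, List.length_range, smul_eq_mul]
    exact Nat.mul_le_mul_right _ hk.le

theorem Comp.flatMap {g : ι → ℕ → List ℕ} (hN : Γ.Scalar N) (hB : PolyBound Γ.size N)
    (hg : (Γ.inLoop N fun i k => (List.range k).flatMap (g i)).Comp fun p => g p.1.1 p.1.2) :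
    Γ.Comp fun i => (List.range (N i)).flatMap (g i) := by
  refine Comp.loop (st := fun i k => (List.range k).flatMap (g i)) hN hB (by simpa using .nil Γ) ?_
  refine (hg.bind (Comp.append_ext (((Var.state _ _ _).ext _).comp
    (flatMap_length_polyBound hB hg.length_polyBound))
    (((Var.last _ _).ext _).comp hg.length_polyBound))).congr fun p => ?_
  simp [List.range_succ]

theorem Comp.map {g : ι → ℕ → ℕ} (hN : Γ.Scalar N) (hB : PolyBound Γ.size N)
    (hg : ∀ st, (Γ.inLoop N st).Comp fun p => [g p.1.1 p.1.2]) :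
    Γ.Comp fun i => (List.range (N i)).map (g i) :=
  (Comp.flatMap (g := fun i k => [g i k]) hN hB (hg _)).congr fun i => by
    rw [List.map_eq_flatMap]

theorem Comp.sum {g : ι → ℕ → ℕ} (hN : Γ.Scalar N) (hB : PolyBound Γ.size N)
    (hg : ∀ st, (Γ.inLoop N st).Comp fun p => [g p.1.1 p.1.2]) :
    Γ.Comp fun i => [∑ k ∈ Finset.range (N i), g i k] := by
  refine Comp.loop (st := fun i k => [∑ k ∈ Finset.range k, g i k]) hN hB
    (by simpa using (Scalar.const Γ 0).comp) ?_
  refine (hg _).bind (((((Var.state _ _ _).ext _).scalar.add (Scalar.last _ _)).comp).congr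
    fun p => ?_)
  rw [Finset.sum_range_succ]

theorem Comp.scalars_three {u v w : ι → ℕ} (hu : Γ.Scalar u) (hv : Γ.Scalar v)
    (hw : Γ.Scalar w) : Γ.Comp fun i => [u i, v i, w i] :=
  (hu.comp.append fun _ => (hv.ext _).comp.append fun _ => ((hw.ext _).ext _).comp).congr
    fun _ => rfl

/-- The context of the initial memories of the inputs `param i :: inp i`, for `d` lists. -/
def start (param : ι → ℕ) (inp : ι → List (List ℕ)) (d : ℕ) : Ctx ι where
  depth := d
  size i := 2 ^ param i + (inp i).flatten.length
  Holds i s := ∀ k < d, HasList s k (([param i] :: inp i).getD k [])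
  agree _ _ _ hs h k hk := hs.hasList hk (h k hk)
  exists_holds i := ⟨Mem.start ([param i] :: inp i), fun _ _ => ⟨rfl, fun _ _ => rfl⟩⟩

theorem Var.start (param : ι → ℕ) (inp : ι → List (List ℕ)) {d k : ℕ} (hk : k < d) :
    (Ctx.start param inp d).Var k fun i => ([param i] :: inp i).getD k [] :=
  ⟨hk, fun _ _ hs => hs k hk⟩

theorem polyBound_start_param (param : ι → ℕ) (inp : ι → List (List ℕ)) (d : ℕ) :
    PolyBound (Ctx.start param inp d).size param :=
  (PolyBound.self _).mono fun _ => Nat.le_add_right_of_le Nat.lt_two_pow_self.le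

theorem polyBound_start_pow (param : ι → ℕ) (inp : ι → List (List ℕ)) (d : ℕ) :
    PolyBound (Ctx.start param inp d).size fun i => 2 ^ param i :=
  (PolyBound.self _).mono fun _ => Nat.le_add_right _ _

theorem Comp.polyTime {param : ι → ℕ} {inp : ι → List (List ℕ)} {d : ℕ}
    (h : (Ctx.start param inp (d + 1)).Comp out) : PolyTime param inp out := by
  obtain ⟨b, c, ⟨q, hq⟩, h⟩ := h.exists_exec
  -- The result is left in the first free slot `d + 1`, but the output of the machine is read from
  -- slot 0.
  refine ⟨.seq c (moveCmd (d + 1) 0 (d + 2)), 22 * q + 30, fun i => ?_⟩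
  obtain ⟨t, s, h1, -, h3, h4⟩ := h i (Mem.start ([param i] :: inp i))
    fun _ _ => ⟨rfl, fun _ _ => rfl⟩
  obtain ⟨t', s', k1, k2, k3, -, -⟩ := exec_moveCmd (a := d + 1) (b := 0) (r := d + 2)
    (by omega) (by omega) (by omega) h3
  refine ⟨_, s', .seq h1 k1, ?_, ?_⟩
  · refine List.ext_getElem (by simp [Mem.output, k3.1]) fun j hj hj' => ?_
    simp [Mem.output, k3.2 j hj', hj']
  · have hqi : b i ≤ q.eval (2 ^ param i + (inp i).flatten.length) := hq i
    simp only [Polynomial.eval_add, Polynomial.eval_mul, Polynomial.eval_ofNat]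
    omega

end Ctx

end

/-! ### Monomial matrices and the unitary of a circuit -/

/-- The monomial matrix `|x⟩ ↦ exp (i π φ(x) / 4) |π x⟩`. -/
noncomputable def monomialMatrix {n : ℕ} (π : Bits n → Bits n) (φ : Bits n → ZMod 8) :
    Operator n :=
  Matrix.of fun y x => if y = π x then ZMod.stdAddChar (φ x) else 0

theorem exp_val_eq (z : ZMod 8) :
    Complex.exp (Complex.I * (Real.pi / 4) * (z.val : ℂ)) = ZMod.stdAddChar z := by
  have h := ZMod.stdAddChar_coe (N := 8) (z.val : ℤ)
  rw [Int.cast_natCast, ZMod.natCast_zmod_val] at h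
  rw [h]
  congr 1
  push_cast
  ring

theorem monomialMatrix_mul {n : ℕ} (π ρ : Bits n → Bits n) (φ ψ : Bits n → ZMod 8) :
    monomialMatrix π φ * monomialMatrix ρ ψ =
      monomialMatrix (fun x => π (ρ x)) fun x => ψ x + φ (ρ x) := by
  ext y x
  simp only [monomialMatrix, Matrix.mul_apply, Matrix.of_apply, mul_ite, mul_zero,
    Finset.sum_ite_eq', Finset.mem_univ, if_true]
  rw [AddChar.map_add_eq_mul]
  split_ifs <;> ring

theorem monomialMatrix_id {n : ℕ} (φ : Bits n → ZMod 8) :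
    monomialMatrix id φ = Matrix.diagonal fun x => ZMod.stdAddChar (φ x) := by
  ext y x
  by_cases h : y = x
  · subst h
    simp [monomialMatrix]
  · simp [monomialMatrix, h]

/-- The column of `x` has one nonzero entry: its row is `π x`, and its value determines `φ x`
because the standard character of `ZMod 8` is injective. -/
theorem monomialMatrix_inj {n : ℕ} {π ρ : Bits n → Bits n} {φ ψ : Bits n → ZMod 8} :
    monomialMatrix π φ = monomialMatrix ρ ψ ↔ π = ρ ∧ φ = ψ := by
  refine ⟨fun h => ?_, fun h => by rw [h.1, h.2]⟩
  have key : ∀ x, π x = ρ x ∧ φ x = ψ x := by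
    intro x
    have hx := congrFun (congrFun h (π x)) x
    simp only [monomialMatrix, Matrix.of_apply, if_true] at hx
    split_ifs at hx with hπ
    · exact ⟨hπ, ZMod.injective_stdAddChar hx⟩
    · rw [← exp_val_eq] at hx
      exact absurd hx (Complex.exp_ne_zero _)
  exact ⟨funext fun x => (key x).1, funext fun x => (key x).2⟩

theorem Tuple.phaseOperator_eq {n : ℕ} (a : Tuple n) :
    a.phaseOperator = monomialMatrix id a.phasePoly := by
  rw [monomialMatrix_id]
  exact congrArg _ (funext fun x => exp_val_eq _)

namespace Gate

variable {n : ℕ}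

/-- The action of a gate on the basis labels. -/
def act : Gate n → Bits n → Bits n
  | cnot c t _ => fun x => Function.update x t (x c + x t)
  | _ => id

/-- The exponent of `T` in a diagonal gate. -/
def weight : Gate n → ℕ
  | cnot _ _ _ => 0
  | T _ => 1
  | P _ => 2
  | Z _ => 4

/-- The qubit of a diagonal gate, or the control of a `CNOT` gate. -/
def qubit : Gate n → Fin n
  | cnot c _ _ => c
  | T q => q
  | P q => q
  | Z q => q

/-- The phase that a gate adds. -/
def phase (g : Gate n) (x : Bits n) : ZMod 8 := g.weight * ((x g.qubit).val : ZMod 8)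

theorem tMatrix_eq (q : Fin n) :
    tMatrix q = monomialMatrix id fun x => ((x q).val : ZMod 8) := by
  rw [monomialMatrix_id]
  refine congrArg _ (funext fun x => ?_)
  rw [← exp_val_eq, ZMod.val_natCast, Nat.mod_eq_of_lt ((ZMod.val_lt _).trans (by norm_num))]

theorem tMatrix_pow (q : Fin n) (k : ℕ) :
    tMatrix q ^ k = monomialMatrix id fun x => k * ((x q).val : ZMod 8) := by
  induction k with
  | zero => simp [monomialMatrix_id]
  | succ k ih =>
    rw [pow_succ, ih, tMatrix_eq, monomialMatrix_mul]
    congr 1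
    funext x
    push_cast
    simp only [id]
    ring

theorem unitary_eq (g : Gate n) : g.unitary = monomialMatrix g.act g.phase := by
  cases g with
  | cnot c t h =>
    ext y x
    simp [unitary, cnotMatrix, monomialMatrix, act, phase, weight]
  | T q =>
    rw [unitary, ← pow_one (tMatrix q), tMatrix_pow]
    rfl
  | P q => exact tMatrix_pow q 2
  | Z q => exact tMatrix_pow q 4

end Gate

namespace Circuit

variable {n : ℕ}

/-- The action of a circuit on the basis labels. -/
def act : Circuit n → Bits n → Bits n
  | [], x => x
  | g :: C, x => act C (g.act x)

/-- The phase that a circuit adds. -/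
def phase : Circuit n → Bits n → ZMod 8
  | [], _ => 0
  | g :: C, x => g.phase x + phase C (g.act x)

theorem unitary_eq (C : Circuit n) : unitary C = monomialMatrix (act C) (phase C) := by
  induction C with
  | nil => exact show (1 : Operator n) = monomialMatrix id 0 by simp [monomialMatrix_id]
  | cons g C ih =>
    rw [unitary, ih, Gate.unitary_eq, monomialMatrix_mul]
    rfl

theorem unitary_eq_iff {C D : Circuit n} :
    unitary C = unitary D ↔ act C = act D ∧ phase C = phase D := by
  rw [unitary_eq, unitary_eq, monomialMatrix_inj]

theorem act_append (C D : Circuit n) (x : Bits n) : act (C ++ D) x = act D (act C x) := by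
  induction C generalizing x with
  | nil => rfl
  | cons g C ih => exact ih _

theorem phase_append (C D : Circuit n) (x : Bits n) :
    phase (C ++ D) x = phase C x + phase D (act C x) := by
  induction C generalizing x with
  | nil => simp [phase, act]
  | cons g C ih => simp [phase, act, ih, add_assoc]

theorem phase_of_cnots {L : Circuit n} (hL : ∀ g ∈ L, g.isCnot = true) (x : Bits n) :
    phase L x = 0 := by
  induction L generalizing x with
  | nil => rfl
  | cons g L ih =>
    rw [phase, ih fun g hg => hL g (List.mem_cons_of_mem _ hg), add_zero]
    have := hL g List.mem_cons_self
    cases g <;> simp_all [Gate.isCnot, Gate.phase, Gate.weight]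

/-- The `CNOT` gates of a circuit. -/
def cnots (C : Circuit n) : Circuit n := C.filter Gate.isCnot

theorem isCnot_of_mem_cnots {C : Circuit n} {g : Gate n} (hg : g ∈ cnots C) :
    g.isCnot = true := (List.mem_filter.1 hg).2

theorem act_cnots (C : Circuit n) : act (cnots C) = act C := by
  induction C with
  | nil => rfl
  | cons g C ih =>
    funext x
    rw [act, ← ih, cnots, List.filter_cons]
    cases g <;> rfl

theorem tCount_append (C D : Circuit n) : tCount (C ++ D) = tCount C + tCount D :=
  List.countP_append

theorem tCount_of_cnots {L : Circuit n} (hL : ∀ g ∈ L, g.isCnot = true) : tCount L = 0 := by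
  refine List.countP_eq_zero.2 fun g hg => ?_
  have := hL g hg
  cases g <;> simp_all [Gate.isCnot, Gate.isT]

end Circuit

/-- The permutation part is no constraint, since diagonal gates fix the labels and the `CNOT` gates
of `C` alone already perform the permutation of `C`. Only the phases have to be compared. -/
theorem implements_iff {n : ℕ} {a : Tuple n} {C : Circuit n} :
    Implements a C ↔ a.phasePoly = Circuit.phase C := by
  constructor
  · rintro ⟨L, hL, h⟩
    rw [Circuit.unitary_eq, Circuit.unitary_eq, Tuple.phaseOperator_eq, monomialMatrix_mul,
      monomialMatrix_inj] at h
    rw [h.2]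
    funext x
    simp [Circuit.phase_of_cnots hL]
  · intro h
    refine ⟨Circuit.cnots C, fun g => Circuit.isCnot_of_mem_cnots, ?_⟩
    rw [Circuit.unitary_eq, Circuit.unitary_eq, Tuple.phaseOperator_eq, monomialMatrix_mul,
      monomialMatrix_inj]
    refine ⟨?_, ?_⟩
    · rw [Circuit.act_cnots]; rfl
    · funext x
      simp [Circuit.phase_of_cnots fun g => Circuit.isCnot_of_mem_cnots, h]

/-! ### The coefficients of a circuit -/

/-- The vector of the binary digits of a number. -/
def toBits (n m : ℕ) : Bits n := fun i => if m.testBit i then 1 else 0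

theorem toBits_xor (n u v : ℕ) : toBits n (u ^^^ v) = toBits n u + toBits n v := by
  funext i
  simp only [toBits, Nat.testBit_xor, Pi.add_apply]
  cases u.testBit i <;> cases v.testBit i <;> decide

theorem toBits_two_pow_dotProduct {n : ℕ} (q : Fin n) (x : Bits n) :
    toBits n (2 ^ (q : ℕ)) ⬝ᵥ x = x q := by
  simp [toBits, dotProduct, Nat.testBit_two_pow, Fin.val_inj]

/-- The effect of a gate on the linear forms on the qubits. -/
def Gate.rowStep {n : ℕ} (r : ℕ → ℕ) : Gate n → ℕ → ℕ
  | .cnot c t _ => Function.update r t (r t ^^^ r c)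
  | _ => r

/-- The linear forms `r` are bounded and define a surjective map. -/
def GoodRows (n : ℕ) (r : ℕ → ℕ) : Prop :=
  (∀ q < n, r q < 2 ^ n) ∧ ∀ y : Bits n, ∃ x, ∀ q : Fin n, toBits n (r q) ⬝ᵥ x = y q

theorem goodRows_two_pow (n : ℕ) : GoodRows n fun q => 2 ^ q :=
  ⟨fun _ hq => Nat.pow_lt_pow_right (by norm_num) hq,
    fun y => ⟨y, fun q => toBits_two_pow_dotProduct q y⟩⟩

theorem Gate.act_rows {n : ℕ} (g : Gate n) (r : ℕ → ℕ) (x : Bits n) :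
    g.act (fun q => toBits n (r q) ⬝ᵥ x) = fun q : Fin n => toBits n (g.rowStep r q) ⬝ᵥ x := by
  cases g with
  | cnot c t h =>
    funext q
    simp only [act, rowStep, Function.update_apply, Fin.val_inj]
    split_ifs
    · rw [toBits_xor, add_dotProduct, add_comm]
    · rfl
  | _ => rfl

theorem Gate.act_act {n : ℕ} (g : Gate n) (x : Bits n) : g.act (g.act x) = x := by
  cases g with
  | cnot c t h =>
    funext q
    simp only [act, Function.update_apply, if_neg h]
    split_ifs with hq
    · rw [hq, ← add_assoc, CharTwo.add_self_eq_zero, zero_add]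
    · rfl
  | _ => rfl

theorem GoodRows.rowStep {n : ℕ} {r : ℕ → ℕ} (hr : GoodRows n r) (g : Gate n) :
    GoodRows n (g.rowStep r) := by
  refine ⟨fun q hq => ?_, fun y => ?_⟩
  · cases g with
    | cnot c t h =>
      simp only [Gate.rowStep, Function.update_apply]
      split_ifs
      · exact Nat.xor_lt_two_pow (hr.1 t t.2) (hr.1 c c.2)
      · exact hr.1 q hq
    | _ => exact hr.1 q hq
  -- A gate acts on the labels as an involution, so an input that yields `g.act y` before the gate
  -- yields `y` after it.
  · obtain ⟨x, hx⟩ := hr.2 (g.act y)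
    refine ⟨x, fun q => ?_⟩
    have h := g.act_rows r x
    rw [funext hx, g.act_act] at h
    exact (congrFun h q).symm

/-- By surjectivity some input gives the form on qubit `q` the value 1, which the zero form never
takes. -/
theorem GoodRows.ne_zero {n : ℕ} {r : ℕ → ℕ} (hr : GoodRows n r) (q : Fin n) : r q ≠ 0 := by
  intro h
  obtain ⟨x, hx⟩ := hr.2 fun _ => 1
  have := hx q
  rw [h] at this
  simp [toBits, dotProduct] at this

/-- The exponent of the form with mask `m` in a circuit that starts on the linear forms `r`. -/
def Circuit.coeffSum {n : ℕ} (r : ℕ → ℕ) (m : ℕ) : Circuit n → ℕ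
  | [] => 0
  | g :: C => (if r g.qubit = m then g.weight else 0) + coeffSum (g.rowStep r) m C

/-- The coefficients of the phase polynomial of a circuit. -/
def Circuit.coeff {n : ℕ} (C : Circuit n) : Tuple n :=
  fun j => (Circuit.coeffSum (fun q => 2 ^ q) (j + 1) C : ZMod 8)

/-- A gate contributes its weight times the value of the form on its qubit. That form has a nonzero
mask below `2 ^ n`, so exactly one position of the tuple receives the contribution. -/
theorem Circuit.sum_coeffSum {n : ℕ} (C : Circuit n) {r : ℕ → ℕ} (hr : GoodRows n r)
    (x : Bits n) :
    ∑ j : Fin (2 ^ n - 1), (coeffSum r (j + 1) C : ZMod 8) * ((nonzeroVec n j ⬝ᵥ x).val : ZMod 8) =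
      phase C fun q => toBits n (r q) ⬝ᵥ x := by
  induction C generalizing r with
  | nil => simp [coeffSum, phase]
  | cons g C ih =>
    have h0 := hr.ne_zero g.qubit
    have h1 := hr.1 g.qubit g.qubit.2
    simp only [coeffSum, phase, Nat.cast_add, add_mul, Finset.sum_add_distrib]
    rw [ih (hr.rowStep g), Gate.act_rows]
    congr 1
    -- Position `j` belongs to the mask `j + 1`, so the mask `r g.qubit` sits at `r g.qubit - 1`.
    rw [Finset.sum_eq_single ⟨r g.qubit - 1, by omega⟩]
    · have h2 : r g.qubit = r g.qubit - 1 + 1 := by omega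
      simp only [if_pos h2, Gate.phase]
      have h3 : nonzeroVec n ⟨r g.qubit - 1, by omega⟩ = toBits n (r g.qubit - 1 + 1) := rfl
      rw [h3, ← h2]
    · intro j _ hj
      rw [if_neg, Nat.cast_zero, zero_mul]
      intro h
      exact hj (Fin.ext (by simp [h]))
    · simp

theorem Circuit.phasePoly_coeff {n : ℕ} (C : Circuit n) :
    (coeff C).phasePoly = phase C := by
  funext x
  have h := sum_coeffSum C (goodRows_two_pow n) x
  simp only [toBits_two_pow_dotProduct] at h
  exact h

theorem implements_coeff {n : ℕ} (C : Circuit n) : Implements (Circuit.coeff C) C :=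
  implements_iff.2 (Circuit.phasePoly_coeff C)

theorem odd_val_natCast (m : ℕ) : Odd ((m : ZMod 8)).val ↔ Odd m := by
  rw [ZMod.val_natCast, Nat.odd_iff, Nat.odd_iff]
  omega

/-- Each gate changes at most one coefficient, and only a `T` gate has odd weight. Hence one more
gate creates at most one new odd coefficient, and only if it is a `T` gate. -/
theorem Circuit.card_odd_coeffSum_le {n : ℕ} (C : Circuit n) (r : ℕ → ℕ) :
    (Finset.univ.filter fun j : Fin (2 ^ n - 1) => Odd (coeffSum r (j + 1) C)).card ≤
      tCount C := by
  induction C generalizing r with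
  | nil => simp [coeffSum]
  | cons g C ih =>
    have hsub : (Finset.univ.filter fun j : Fin (2 ^ n - 1) => Odd (coeffSum r (j + 1) (g :: C))) ⊆
        (Finset.univ.filter fun j : Fin (2 ^ n - 1) =>
          Odd (coeffSum (g.rowStep r) (j + 1) C)) ∪
        Finset.univ.filter fun j : Fin (2 ^ n - 1) => r g.qubit = j + 1 ∧ g.isT = true := by
      intro j hj
      have hj' := (Finset.mem_filter.1 hj).2
      rw [coeffSum] at hj'
      simp only [Finset.mem_filter, Finset.mem_univ, true_and, Finset.mem_union]
      by_contra! h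
      rw [Nat.not_odd_iff_even] at h
      refine Nat.not_even_iff_odd.2 hj' (Even.add ?_ h.1)
      split_ifs with hr
      · have := h.2 hr
        cases g <;> simp_all [Gate.isT, Gate.weight, Nat.even_iff]
      · simp
    refine (Finset.card_le_card hsub).trans ((Finset.card_union_le _ _).trans ?_)
    rw [tCount, List.countP_cons]
    refine add_le_add (ih _) ?_
    split_ifs with hT
    · refine Finset.card_le_one.2 fun i hi j hj => ?_
      simp only [Finset.mem_filter, Finset.mem_univ, true_and] at hi hj
      exact Fin.ext (by omega)
    · simp [hT]

theorem Circuit.oddCount_coeff_le {n : ℕ} (C : Circuit n) :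
    Tuple.oddCount (coeff C) ≤ tCount C := by
  refine le_trans (le_of_eq ?_) (card_odd_coeffSum_le C fun q => 2 ^ q)
  simp only [Tuple.oddCount, coeff, odd_val_natCast]

/-! ### The circuit of a tuple of coefficients -/

/-- The highest qubit of the `j`-th nonzero vector. -/
def topQubit {n : ℕ} (j : Fin (2 ^ n - 1)) : Fin n :=
  ⟨Nat.log2 (j + 1), (Nat.log2_lt (Nat.succ_ne_zero _)).2 (by omega)⟩

/-- The `CNOT` gates with target `t` and the controls in `ks` that are digits of `m`. -/
def ladder {n : ℕ} (m : ℕ) (t : Fin n) (ks : List (Fin n)) : Circuit n :=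
  ks.flatMap fun k => if h : k ≠ t then if m.testBit k then [.cnot k t h] else [] else []

/-- The diagonal gates on the qubit `t` with total exponent `v`. -/
def phaseGates {n : ℕ} (t : Fin n) (v : ℕ) : Circuit n :=
  (if v % 2 = 0 then [] else [.T t]) ++
    ((if v / 2 % 2 = 0 then [] else [.P t]) ++ if v / 2 / 2 % 2 = 0 then [] else [.Z t])

/-- The circuit of one term of a phase polynomial. -/
def termCircuit {n : ℕ} (j : Fin (2 ^ n - 1)) (v : ℕ) : Circuit n :=
  ladder (j + 1) (topQubit j) (List.finRange n) ++
    (phaseGates (topQubit j) v ++ ladder (j + 1) (topQubit j) (List.finRange n))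

/-- The circuit of a tuple of coefficients. -/
def Tuple.synth {n : ℕ} (a : Tuple n) : Circuit n :=
  (List.finRange (2 ^ n - 1)).flatMap fun j => termCircuit j (a j).val

theorem isCnot_of_mem_ladder {n m : ℕ} {t : Fin n} {ks : List (Fin n)} {g : Gate n}
    (hg : g ∈ ladder m t ks) : g.isCnot = true := by
  obtain ⟨k, -, hk⟩ := List.mem_flatMap.1 hg
  split_ifs at hk
  · obtain rfl := List.mem_singleton.1 hk
    rfl
  · cases hk
  · cases hk

/-- The controls differ from the target `t`, so they keep their values while the target accumulates
them. -/
theorem act_ladder {n m : ℕ} {t : Fin n} (ks : List (Fin n)) (x : Bits n) :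
    Circuit.act (ladder m t ks) x = Function.update x t
      (x t + (ks.map fun k => if k ≠ t then toBits n m k * x k else 0).sum) := by
  induction ks generalizing x with
  | nil => simp [ladder, Circuit.act]
  | cons k ks ih =>
    have hcons : ladder m t (k :: ks) =
        (if h : k ≠ t then if m.testBit k then [.cnot k t h] else [] else []) ++ ladder m t ks :=
      rfl
    rw [hcons, Circuit.act_append, ih]
    by_cases h : k = t
    · simp [h, Circuit.act]
    · by_cases hm : m.testBit k
      · simp only [ne_eq, h, not_false_eq_true, dite_true, hm, if_true, Circuit.act, Gate.act,
          Function.update_idem, Function.update_self, List.map_cons, List.sum_cons, toBits, one_mul]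
        congr 1
        rw [add_comm (x k), add_assoc]
        congr 3
        refine List.map_congr_left fun i _ => ?_
        by_cases hi : i = t <;> simp [hi]
      · simp [h, hm, Circuit.act, toBits]

/-- Since `t` is itself a digit of `m`, the initial content of the target supplies the one term that
the ladder skips. -/
theorem act_ladder_finRange {n m : ℕ} {t : Fin n} (ht : m.testBit t = true) (x : Bits n) :
    Circuit.act (ladder m t (List.finRange n)) x = Function.update x t (toBits n m ⬝ᵥ x) := by
  rw [act_ladder, ← List.ofFn_eq_map, List.sum_ofFn, dotProduct,
    ← Finset.add_sum_erase _ _ (Finset.mem_univ t), ← Finset.sum_filter, Finset.filter_ne']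
  simp [toBits, ht]

theorem act_ladder_act_ladder {n m : ℕ} {t : Fin n} (ht : m.testBit t = true) (x : Bits n) :
    Circuit.act (ladder m t (List.finRange n))
      (Circuit.act (ladder m t (List.finRange n)) x) = x := by
  rw [act_ladder_finRange ht, act_ladder_finRange ht, Function.update_idem]
  refine (Function.update_eq_self_iff ..).2 ?_
  have ht' : toBits n m t = 1 := by simp [toBits, ht]
  simp only [dotProduct, ← Finset.add_sum_erase _ _ (Finset.mem_univ t), Function.update_self, ht',
    one_mul]
  -- The terms away from `t` do not see the update, so the second ladder adds the same sum again and
  -- it cancels.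
  have : ∑ i ∈ Finset.univ.erase t, toBits n m i *
      Function.update x t (x t + ∑ i ∈ Finset.univ.erase t, toBits n m i * x i) i =
      ∑ i ∈ Finset.univ.erase t, toBits n m i * x i :=
    Finset.sum_congr rfl fun i hi => by rw [Function.update_of_ne (Finset.ne_of_mem_erase hi)]
  rw [this, add_assoc, CharTwo.add_self_eq_zero, add_zero]

theorem act_phaseGates {n : ℕ} (t : Fin n) (v : ℕ) (x : Bits n) :
    Circuit.act (phaseGates t v) x = x := by
  simp only [phaseGates]
  split_ifs <;> rfl

theorem phase_phaseGates {n : ℕ} (t : Fin n) (v : ZMod 8) (x : Bits n) :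
    Circuit.phase (phaseGates t v.val) x = v * ((x t).val : ZMod 8) := by
  -- The three binary digits of the exponent correspond to `T`, `P` and `Z`.
  have h : ∀ (v : ZMod 8) (b : ZMod 8),
      v * b = (if v.val % 2 = 0 then 0 else b) + ((if v.val / 2 % 2 = 0 then 0 else 2 * b) +
        if v.val / 2 / 2 % 2 = 0 then 0 else 4 * b) := by decide
  rw [h]
  simp only [phaseGates, Circuit.phase_append]
  split_ifs <;> simp [Circuit.phase, Circuit.act, Gate.phase, Gate.weight, Gate.qubit, Gate.act]

theorem testBit_topQubit {n : ℕ} (j : Fin (2 ^ n - 1)) :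
    ((j : ℕ) + 1).testBit (topQubit j) = true := Nat.testBit_log2 (Nat.succ_ne_zero _)

theorem act_termCircuit {n : ℕ} (j : Fin (2 ^ n - 1)) (v : ℕ) (x : Bits n) :
    Circuit.act (termCircuit j v) x = x := by
  rw [termCircuit, Circuit.act_append, Circuit.act_append, act_phaseGates,
    act_ladder_act_ladder (testBit_topQubit j)]

theorem phase_termCircuit {n : ℕ} (j : Fin (2 ^ n - 1)) (v : ZMod 8) (x : Bits n) :
    Circuit.phase (termCircuit j v.val) x = v * ((nonzeroVec n j ⬝ᵥ x).val : ZMod 8) := by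
  rw [termCircuit, Circuit.phase_append, Circuit.phase_append, phase_phaseGates,
    Circuit.phase_of_cnots fun g => isCnot_of_mem_ladder,
    Circuit.phase_of_cnots fun g => isCnot_of_mem_ladder,
    act_ladder_finRange (testBit_topQubit j), Function.update_self, zero_add, add_zero]
  rfl

theorem tCount_termCircuit {n : ℕ} (j : Fin (2 ^ n - 1)) (v : ℕ) :
    Circuit.tCount (termCircuit j v) = if Odd v then 1 else 0 := by
  rw [termCircuit, Circuit.tCount_append, Circuit.tCount_append,
    Circuit.tCount_of_cnots fun g => isCnot_of_mem_ladder, phaseGates, Circuit.tCount_append,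
    Circuit.tCount_append]
  rcases Nat.mod_two_eq_zero_or_one v with h | h <;> simp only [Nat.odd_iff, h] <;>
    split_ifs <;> simp_all [Circuit.tCount, Gate.isT]

theorem act_flatMap_termCircuit {n : ℕ} (a : Tuple n) (l : List (Fin (2 ^ n - 1))) (x : Bits n) :
    Circuit.act (l.flatMap fun j => termCircuit j (a j).val) x = x := by
  induction l with
  | nil => rfl
  | cons j l ih => rw [List.flatMap_cons, Circuit.act_append, act_termCircuit, ih]

theorem phase_flatMap_termCircuit {n : ℕ} (a : Tuple n) (l : List (Fin (2 ^ n - 1)))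
    (x : Bits n) : Circuit.phase (l.flatMap fun j => termCircuit j (a j).val) x =
      (l.map fun j => a j * ((nonzeroVec n j ⬝ᵥ x).val : ZMod 8)).sum := by
  induction l with
  | nil => rfl
  | cons j l ih =>
    rw [List.flatMap_cons, Circuit.phase_append, act_termCircuit, phase_termCircuit, ih,
      List.map_cons, List.sum_cons]

theorem Tuple.act_synth {n : ℕ} (a : Tuple n) (x : Bits n) : Circuit.act a.synth x = x :=
  act_flatMap_termCircuit a _ x

theorem Tuple.phase_synth {n : ℕ} (a : Tuple n) : Circuit.phase a.synth = a.phasePoly := by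
  funext x
  rw [Tuple.synth, phase_flatMap_termCircuit, ← List.ofFn_eq_map, List.sum_ofFn]
  rfl

theorem Tuple.unitary_synth {n : ℕ} (a : Tuple n) :
    Circuit.unitary a.synth = a.phaseOperator := by
  rw [Circuit.unitary_eq, Tuple.phaseOperator_eq, monomialMatrix_inj]
  exact ⟨funext a.act_synth, a.phase_synth⟩

theorem Tuple.tCount_synth {n : ℕ} (a : Tuple n) : Circuit.tCount a.synth = a.oddCount := by
  have h : ∀ l : List (Fin (2 ^ n - 1)), Circuit.tCount (l.flatMap fun j =>
      termCircuit j (a j).val) = (l.map fun j => if Odd (a j).val then 1 else 0).sum := by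
    intro l
    induction l with
    | nil => rfl
    | cons j l ih =>
      rw [List.flatMap_cons, Circuit.tCount_append, tCount_termCircuit, ih, List.map_cons,
        List.sum_cons]
  rw [Tuple.synth, h, ← List.ofFn_eq_map, List.sum_ofFn, Tuple.oddCount, Finset.card_filter]

section

/-! ### Sums over the nonzero vectors -/

theorem nonzeroVec_apply {n : ℕ} (j : Fin (2 ^ n - 1)) :
    nonzeroVec n j = toBits n (j + 1) := rfl

theorem toBits_injective (n : ℕ) : Function.Injective fun m : Fin (2 ^ n) => toBits n m := by
  intro a b hab
  refine Fin.ext (Nat.eq_of_testBit_eq fun i => ?_)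
  by_cases hi : i < n
  · have h := congrFun hab ⟨i, hi⟩
    simp only [toBits] at h
    cases h1 : (a : ℕ).testBit i <;> cases h2 : (b : ℕ).testBit i <;> simp_all
  · have h2 : 2 ^ n ≤ 2 ^ i := Nat.pow_le_pow_right (by norm_num) (not_lt.1 hi)
    rw [Nat.testBit_lt_two_pow (a.2.trans_le h2), Nat.testBit_lt_two_pow (b.2.trans_le h2)]

theorem nonzeroVec_injective (n : ℕ) : Function.Injective (nonzeroVec n) := by
  intro i j h
  have hi : (i : ℕ) + 1 < 2 ^ n := by omega
  have hj : (j : ℕ) + 1 < 2 ^ n := by omega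
  have := @toBits_injective n ⟨i + 1, hi⟩ ⟨j + 1, hj⟩ h
  exact Fin.ext (by simpa using this)

theorem nonzeroVec_ne_zero {n : ℕ} (j : Fin (2 ^ n - 1)) : nonzeroVec n j ≠ 0 := by
  intro h
  have hj : (j : ℕ) + 1 < 2 ^ n := by omega
  have := @toBits_injective n ⟨j + 1, hj⟩ ⟨0, by positivity⟩
    (show toBits n (j + 1) = toBits n 0 from h.trans (by funext i; simp [toBits]))
  simp at this

theorem sum_bits {M : Type*} [AddCommMonoid M] {n : ℕ} (h : Bits n → M) :
    ∑ y, h y = h 0 + ∑ j, h (nonzeroVec n j) := by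
  have hbij : Function.Bijective fun m : Fin (2 ^ n) => toBits n m :=
    (Fintype.bijective_iff_injective_and_card _).2 ⟨toBits_injective n, by simp⟩
  have hn : 2 ^ n = (2 ^ n - 1) + 1 := (Nat.sub_add_cancel Nat.one_le_two_pow).symm
  rw [← hbij.sum_comp, ← (finCongr hn.symm).sum_comp, Fin.sum_univ_succ]
  congr 1
  refine congrArg h (funext fun i => ?_)
  simp [toBits]

/-- The support of a vector of bits. -/
def supp {n : ℕ} (x : Bits n) : Finset (Fin n) := Finset.univ.filter fun i => x i = 1

@[simp] theorem mem_supp {n : ℕ} {x : Bits n} {i : Fin n} : i ∈ supp x ↔ x i = 1 := by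
  simp [supp]

theorem supp_bijective (n : ℕ) : Function.Bijective (supp (n := n)) := by
  have h01 : ∀ b : ZMod 2, b = 0 ∨ b = 1 := by decide
  refine ⟨fun x y h => funext fun i => ?_, fun s => ⟨fun i => if i ∈ s then 1 else 0, ?_⟩⟩
  · have hi := Finset.ext_iff.1 h i
    simp only [mem_supp] at hi
    rcases h01 (x i) with hx | hx <;> rcases h01 (y i) with hy | hy <;> simp_all
  · ext i
    simp

/-- Sums over positions become sums over all sets of qubits. The empty set is the support of the
zero vector, which is no position, hence the condition `h`. -/
theorem sum_supp_nonzeroVec {M : Type*} [AddCommMonoid M] {n : ℕ} (G : Finset (Fin n) → M)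
    (h : G ∅ = 0) : ∑ j, G (supp (nonzeroVec n j)) = ∑ Y, G Y := by
  have h0 : supp (0 : Bits n) = ∅ := by ext; simp
  rw [← (supp_bijective n).sum_comp, sum_bits, h0, h, zero_add]

theorem val_dotProduct {n : ℕ} (y x : Bits n) :
    (y ⬝ᵥ x).val = (supp y ∩ supp x).card % 2 := by
  have h : y ⬝ᵥ x = ((supp y ∩ supp x).card : ZMod 2) := by
    have hm : ∀ a b : ZMod 2, a * b = if a = 1 ∧ b = 1 then 1 else 0 := by decide
    simp only [dotProduct, hm, Finset.sum_boole]
    congr 2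
    ext i
    simp
  rw [h, ZMod.val_natCast]

/-! ### Residues of tuples -/

variable {n : ℕ}

theorem Tuple.res_eq (a : Tuple n) :
    a.res = fun j => ZMod.castHom (show 2 ∣ 8 by norm_num) (ZMod 2) (a j) := by
  funext j
  rw [Tuple.res, ZMod.castHom_apply, ZMod.natCast_val]

theorem Tuple.res_add (a b : Tuple n) : (a + b).res = a.res + b.res := by
  simp only [Tuple.res_eq, Pi.add_apply, map_add]
  rfl

theorem Tuple.res_sub (a b : Tuple n) : (a - b).res = a.res - b.res := by
  simp only [Tuple.res_eq, Pi.sub_apply, map_sub]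
  rfl

theorem Word.res_lift (w : Word n) : w.lift.res = w := by
  funext j
  rw [Tuple.res_eq]
  simp [Word.lift]

theorem Tuple.oddCount_eq (a : Tuple n) : a.oddCount = hammingNorm a.res := by
  simp only [Tuple.oddCount, hammingNorm, Tuple.res, ne_eq, ZMod.natCast_eq_zero_iff_even,
    Nat.not_even_iff_odd]

theorem hammingDist_eq_hammingNorm_add (x y : Word n) : hammingDist x y = hammingNorm (x + y) := by
  rw [hammingDist_eq_hammingNorm]
  congr 1
  funext j
  rw [Pi.add_apply, Pi.add_apply, Pi.neg_apply, CharTwo.neg_eq]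

theorem Tuple.phasePoly_add (a b : Tuple n) : (a + b).phasePoly = a.phasePoly + b.phasePoly := by
  funext x
  simp only [Tuple.phasePoly, Pi.add_apply, add_mul, Finset.sum_add_distrib]

theorem Tuple.phasePoly_sub (a b : Tuple n) : (a - b).phasePoly = a.phasePoly - b.phasePoly := by
  funext x
  simp only [Tuple.phasePoly, Pi.sub_apply, sub_mul, Finset.sum_sub_distrib]

/-! ### The residue of a vanishing phase polynomial is a codeword -/

/-- Inclusion and exclusion writes `4bcd` as an alternating sum of the bits `b`, `c`, `d`, their
pairwise sums and their total sum. Summed against `a`, the right side consists of seven values of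
the phase polynomial, all zero; and `4v = 0` modulo 8 forces `v` to be even. -/
theorem Tuple.sum_res_mul_eq_zero {a : Tuple n} (ha : a.phasePoly = 0) (x y z : Bits n) :
    ∑ j, a.res j * ((nonzeroVec n j ⬝ᵥ x) * (nonzeroVec n j ⬝ᵥ y) * (nonzeroVec n j ⬝ᵥ z)) = 0 := by
  have key : ∀ b c d : ZMod 2, (4 * (b * c * d).val : ZMod 8) =
      b.val + c.val + d.val - (b + c).val - (b + d).val - (c + d).val + (b + c + d).val := by
    decide
  have h4 : (4 : ZMod 8) * ∑ j, a j * (((nonzeroVec n j ⬝ᵥ x) * (nonzeroVec n j ⬝ᵥ y) *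
      (nonzeroVec n j ⬝ᵥ z)).val : ZMod 8) = 0 := by
    have hs : a.phasePoly x + a.phasePoly y + a.phasePoly z - a.phasePoly (x + y)
        - a.phasePoly (x + z) - a.phasePoly (y + z) + a.phasePoly (x + y + z) = 0 := by
      simp [ha]
    rw [← hs]
    simp only [Tuple.phasePoly, Finset.mul_sum, ← Finset.sum_add_distrib,
      ← Finset.sum_sub_distrib]
    refine Finset.sum_congr rfl fun j _ => ?_
    rw [mul_left_comm, key]
    simp only [dotProduct_add]
    ring
  have h2 : ∀ v : ZMod 8, 4 * v = 0 → ZMod.castHom (show 2 ∣ 8 by norm_num) (ZMod 2) v = 0 := by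
    decide
  have h := h2 _ h4
  rw [map_sum] at h
  rw [← h, Tuple.res_eq]
  refine Finset.sum_congr rfl fun j _ => ?_
  rw [map_mul, map_natCast, ZMod.natCast_zmod_val]

/-- This is the duality of Reed-Muller codes, proved by interpolation: the coefficient of a
squarefree monomial with variable set `M` is the sum of the word against a polynomial of degree `n -
|M|`, which vanishes when that degree is at most 3. -/
theorem mem_puncturedRM_of_sum_eq_zero {w : Word n}
    (hw : ∀ i k l, ∑ j, w j * (nonzeroVec n j i * nonzeroVec n j k * nonzeroVec n j l) = 0) :
    w ∈ puncturedRM ((n : ℤ) - 4) n := by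
  classical
  -- Repeated indices turn the cubic conditions into the conditions of degree 1 and 2.
  have hidem : ∀ a b : ZMod 2, a = a * a * a ∧ a * b = a * a * b := by decide
  have h1 : ∀ i, ∑ j, w j * nonzeroVec n j i = 0 := fun i => by
    rw [← hw i i i]
    exact Finset.sum_congr rfl fun j _ => by rw [← (hidem _ 0).1]
  have h2 : ∀ i k, ∑ j, w j * (nonzeroVec n j i * nonzeroVec n j k) = 0 := fun i k => by
    rw [← hw i i k]
    exact Finset.sum_congr rfl fun j _ => by rw [← (hidem _ _).2]
  -- The value at the origin is free, because the code is punctured there. This choice makes the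
  -- extended word orthogonal to the constant 1 as well.
  set w₀ : ZMod 2 := ∑ j, w j with hw₀
  let F (y : Bits n) : MvPolynomial (Fin n) (ZMod 2) :=
    ∏ i, (MvPolynomial.X i + MvPolynomial.C (y i + 1))
  have hF : ∀ y z : Bits n, MvPolynomial.eval z (F y) = if z = y then 1 else 0 := by
    intro y z
    have hb : ∀ a b : ZMod 2, a + (b + 1) = if a = b then 1 else 0 := by decide
    simp only [F, map_prod, map_add, MvPolynomial.eval_X, MvPolynomial.eval_C, hb]
    rw [Finset.prod_ite_zero]
    simp [funext_iff]
  -- Expanding the indicator polynomials and exchanging the sums collects the coefficient of each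
  -- squarefree monomial.
  have hexp : MvPolynomial.C w₀ * F 0 + ∑ j, MvPolynomial.C (w j) * F (nonzeroVec n j) =
      ∑ M : Finset (Fin n), (∏ i ∈ M, MvPolynomial.X i) * MvPolynomial.C
        (w₀ + ∑ j, w j * ∏ i ∈ Mᶜ, (nonzeroVec n j i + 1)) := by
    have hFM : ∀ y, F y = ∑ M : Finset (Fin n), (∏ i ∈ M, MvPolynomial.X i) *
        MvPolynomial.C (∏ i ∈ Mᶜ, (y i + 1)) := by
      intro y
      simp only [F]
      rw [Finset.prod_add, Finset.powerset_univ]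
      simp only [map_prod, Finset.compl_eq_univ_sdiff]
    simp only [hFM, Finset.mul_sum]
    rw [Finset.sum_comm, ← Finset.sum_add_distrib]
    refine Finset.sum_congr rfl fun M _ => ?_
    simp only [map_add, map_sum, map_mul, mul_add, Finset.mul_sum, Pi.zero_apply, zero_add,
      Finset.prod_const_one, map_one, mul_one]
    congr 1
    · ring
    · exact Finset.sum_congr rfl fun j _ => by ring
  -- Expanding the product gives monomials of degree at most 3. Those of positive degree sum to zero
  -- by the hypothesis, and the constant one gives a second `w₀`.
  have hvanish : ∀ M : Finset (Fin n), Mᶜ.card ≤ 3 →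
      w₀ + ∑ j, w j * ∏ i ∈ Mᶜ, (nonzeroVec n j i + 1) = 0 := by
    intro M hM
    have hcases : Mᶜ.card = 0 ∨ Mᶜ.card = 1 ∨ Mᶜ.card = 2 ∨ Mᶜ.card = 3 := by omega
    rcases hcases with h | h | h | h
    · rw [Finset.card_eq_zero.1 h]
      simp only [Finset.prod_empty, mul_one, ← hw₀]
      exact CharTwo.add_self_eq_zero _
    · obtain ⟨i, hi⟩ := Finset.card_eq_one.1 h
      simp only [hi, Finset.prod_singleton, mul_add, Finset.sum_add_distrib, h1, mul_one, ← hw₀,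
        zero_add]
      exact CharTwo.add_self_eq_zero _
    · obtain ⟨i, k, hik, hi⟩ := Finset.card_eq_two.1 h
      have he : ∀ j, w j * ((nonzeroVec n j i + 1) * (nonzeroVec n j k + 1)) =
          w j * (nonzeroVec n j i * nonzeroVec n j k) + w j * nonzeroVec n j i +
            w j * nonzeroVec n j k + w j := fun j => by ring
      simp only [hi, Finset.prod_pair hik, he, Finset.sum_add_distrib, h1, h2, ← hw₀, zero_add]
      exact CharTwo.add_self_eq_zero _
    · obtain ⟨i, k, l, hik, hil, hkl, hi⟩ := Finset.card_eq_three.1 h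
      have he : ∀ j, w j * ((nonzeroVec n j i + 1) * ((nonzeroVec n j k + 1) *
          (nonzeroVec n j l + 1))) =
          w j * (nonzeroVec n j i * nonzeroVec n j k * nonzeroVec n j l) +
          w j * (nonzeroVec n j i * nonzeroVec n j k) + w j * (nonzeroVec n j i * nonzeroVec n j l) +
          w j * (nonzeroVec n j k * nonzeroVec n j l) + w j * nonzeroVec n j i +
            w j * nonzeroVec n j k + w j * nonzeroVec n j l + w j := fun j => by ring
      simp only [hi]
      rw [Finset.sum_congr rfl fun j _ => by
        rw [Finset.prod_insert (by simp [hik, hil]), Finset.prod_pair hkl, he]]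
      simp only [Finset.sum_add_distrib, h1, h2, hw, ← hw₀, zero_add]
      exact CharTwo.add_self_eq_zero _
  refine ⟨MvPolynomial.C w₀ * F 0 + ∑ j, MvPolynomial.C (w j) * F (nonzeroVec n j), ?_, ?_⟩
  · intro m hm
    rw [hexp] at hm
    obtain ⟨M, -, hM⟩ := Finset.mem_biUnion.1 (MvPolynomial.support_sum hm)
    have hc : 3 < Mᶜ.card := by
      by_contra! hc
      rw [hvanish M hc, map_zero, mul_zero] at hM
      simp at hM
    have hle : m.degree ≤ M.card := by
      have h := MvPolynomial.le_totalDegree hM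
      refine (le_of_eq ?_).trans (h.trans ((MvPolynomial.totalDegree_mul _ _).trans ?_))
      · rfl
      · rw [MvPolynomial.totalDegree_C, add_zero]
        refine (MvPolynomial.totalDegree_finsetProd _ _).trans ?_
        simp
    rw [Finset.card_compl, Fintype.card_fin] at hc
    omega
  · intro j
    simp only [map_add, map_mul, map_sum, MvPolynomial.eval_C, hF, nonzeroVec_ne_zero, if_false,
      mul_zero, zero_add, (nonzeroVec_injective n).eq_iff, mul_ite, mul_one,
      Finset.sum_ite_eq, Finset.mem_univ, if_true]

theorem Tuple.res_mem_puncturedRM {a : Tuple n} (ha : a.phasePoly = 0) :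
    a.res ∈ puncturedRM ((n : ℤ) - 4) n := by
  refine mem_puncturedRM_of_sum_eq_zero fun i k l => ?_
  simpa using a.sum_res_mul_eq_zero ha (Pi.single i 1) (Pi.single k 1) (Pi.single l 1)

/-! ### Codewords are residues of vanishing phase polynomials -/

/-- Multiplying by three variables gives degree at most `n - 1`, and a polynomial of degree below
`n` sums to zero over `𝔽₂ⁿ`. The origin, which the word lacks, contributes nothing because the
variables vanish there. -/
theorem sum_eq_zero_of_mem_puncturedRM {w : Word n} (hw : w ∈ puncturedRM ((n : ℤ) - 4) n)
    (i k l : Fin n) :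
    ∑ j, w j * (nonzeroVec n j i * nonzeroVec n j k * nonzeroVec n j l) = 0 := by
  obtain ⟨f, hf, hw⟩ := hw
  by_cases hf0 : f = 0
  · simp [hw, hf0]
  -- A nonzero polynomial has a monomial of degree at least 0 and at most `n - 4`; from here on `n -
  -- 4` is also the natural-number difference.
  have hn : 4 ≤ n := by
    obtain ⟨m, hm⟩ := MvPolynomial.support_nonempty.2 hf0
    have := hf m hm
    omega
  have hdeg : f.totalDegree ≤ n - 4 := by
    refine Finset.sup_le fun m hm => ?_
    have h : (m.degree : ℤ) ≤ n - 4 := hf m hm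
    have h' : m.degree = m.sum fun _ e => e := rfl
    omega
  have h := MvPolynomial.sum_eval_eq_zero
    (f * (MvPolynomial.X i * MvPolynomial.X k * MvPolynomial.X l)) (by
      have h1 := MvPolynomial.totalDegree_mul f
        (MvPolynomial.X i * MvPolynomial.X k * MvPolynomial.X l)
      have h2 := MvPolynomial.totalDegree_mul (MvPolynomial.X i * MvPolynomial.X k :
        MvPolynomial (Fin n) (ZMod 2)) (MvPolynomial.X l)
      have h3 := MvPolynomial.totalDegree_mul (MvPolynomial.X i :
        MvPolynomial (Fin n) (ZMod 2)) (MvPolynomial.X k)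
      simp only [MvPolynomial.totalDegree_X] at h1 h2 h3
      rw [ZMod.card, Fintype.card_fin]
      omega)
  rw [sum_bits] at h
  simpa [← hw] using h

/-- The number of ones of a word at the positions of the vectors whose support contains `T`. -/
def countAbove (w : Word n) (T : Finset (Fin n)) : ℕ :=
  ∑ j, if T ⊆ supp (nonzeroVec n j) then (w j).val else 0

/-- The indices may coincide, so this covers every nonempty set of at most three qubits. -/
theorem even_countAbove {w : Word n} (hw : w ∈ puncturedRM ((n : ℤ) - 4) n)
    (i k l : Fin n) : Even (countAbove w {i, k, l}) := by
  rw [← ZMod.natCast_eq_zero_iff_even, ← sum_eq_zero_of_mem_puncturedRM hw i k l, countAbove,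
    Nat.cast_sum]
  refine Finset.sum_congr rfl fun j _ => ?_
  have h : ∀ a b c : ZMod 2, a * b * c = if a = 1 ∧ b = 1 ∧ c = 1 then 1 else 0 := by decide
  rw [h]
  simp only [Finset.insert_subset_iff, Finset.singleton_subset_iff, mem_supp]
  split_ifs <;> simp

/-- The factor of the correction, for a vector of weight `y` below a vector of weight `z`. -/
def corrFactor (y z : ℕ) : ℕ := if y = 1 then 7 * z else if y = 2 then 1 else 0

/-- The coefficients `a` such that `w.lift + a` has a vanishing phase polynomial if `w` is a
codeword. -/
def Word.corr (w : Word n) : Tuple n := fun j =>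
  ((∑ k, if supp (nonzeroVec n j) ⊆ supp (nonzeroVec n k) then
    (w k).val * corrFactor (supp (nonzeroVec n j)).card (supp (nonzeroVec n k)).card else 0 : ℕ) :
      ZMod 8)

/-- On weight 2 a coefficient counts the ones of `w` above a pair, on weight 1 it is 7 times a sum
of such counts with `l = i` allowed, and elsewhere it is zero. All these counts are even for a
codeword. -/
theorem Word.res_corr {w : Word n} (hw : w ∈ puncturedRM ((n : ℤ) - 4) n) : w.corr.res = 0 := by
  funext j
  rw [Tuple.res_eq]
  simp only [Word.corr, map_natCast, Pi.zero_apply]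
  rw [ZMod.natCast_eq_zero_iff_even]
  set Y := supp (nonzeroVec n j)
  by_cases h1 : Y.card = 1
  · obtain ⟨i, hi⟩ := Finset.card_eq_one.1 h1
    -- Summing over `l` the number of ones above `{i, l}` counts each vector through `i` as often as
    -- its weight.
    have h : (∑ k, if Y ⊆ supp (nonzeroVec n k) then
        (w k).val * corrFactor Y.card (supp (nonzeroVec n k)).card else 0) =
        7 * ∑ l, countAbove w {i, i, l} := by
      simp only [countAbove, h1, corrFactor, if_true]
      simp only [hi, Finset.insert_subset_iff, Finset.singleton_subset_iff]
      rw [Finset.sum_comm, Finset.mul_sum]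
      refine Finset.sum_congr rfl fun k _ => ?_
      split_ifs with hk
      · simp only [hk, true_and]
        rw [← Finset.sum_filter, Finset.filter_mem_eq_inter, Finset.univ_inter,
          Finset.sum_const, smul_eq_mul]
        ring
      · simp [hk]
    rw [h]
    exact (Finset.even_sum _ fun l _ => even_countAbove hw i i l).mul_left _
  · by_cases h2 : Y.card = 2
    · obtain ⟨i, k, -, hi⟩ := Finset.card_eq_two.1 h2
      have h := even_countAbove hw i i k
      rw [Finset.insert_idem, ← hi, countAbove] at h
      simpa [corrFactor, h2] using h
    · simp [corrFactor, h1, h2]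

/-- A pair meets `X` in an odd number of points exactly when it has one point inside `X` and one
outside. In the induction, the pairs through the new point `a` contribute the number of points of
`Z` on the other side of `X`. -/
theorem sum_powersetCard_two_mod_two {α : Type*} [DecidableEq α] (Z X : Finset α) :
    ∑ Y ∈ Z.powersetCard 2, (Y ∩ X).card % 2 = (Z ∩ X).card * (Z \ X).card := by
  induction Z using Finset.induction_on with
  | empty => simp
  | insert a Z ha ih =>
    have hdisj : Disjoint (Z.powersetCard 2) ((Z.powersetCard 1).image (insert a)) := by
      refine Finset.disjoint_left.2 fun Y hY hY' => ?_
      obtain ⟨Y', -, rfl⟩ := Finset.mem_image.1 hY'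
      exact ha ((Finset.mem_powersetCard.1 hY).1 (Finset.mem_insert_self _ _))
    have hinj : Set.InjOn (insert a) (Z.powersetCard 1 : Set (Finset α)) := by
      intro Y hY Y' hY' h
      have h1 : a ∉ Y := fun h => ha ((Finset.mem_powersetCard.1 hY).1 h)
      have h2 : a ∉ Y' := fun h => ha ((Finset.mem_powersetCard.1 hY').1 h)
      rw [← Finset.erase_insert h1, h, Finset.erase_insert h2]
    have hcardZ : (Z ∩ X).card = ∑ b ∈ Z, if b ∈ X then 1 else 0 := by
      rw [Finset.sum_boole, Finset.filter_mem_eq_inter, Nat.cast_id]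
    have hcardZ' : (Z \ X).card = ∑ b ∈ Z, if b ∈ X then 0 else 1 := by
      rw [← Finset.filter_notMem_eq_sdiff, Finset.card_filter]
      exact Finset.sum_congr rfl fun b _ => by by_cases h : b ∈ X <;> simp [h]
    rw [Finset.powersetCard_succ_insert ha, Finset.sum_union hdisj, Finset.sum_image hinj, ih,
      Finset.powersetCard_one, Finset.sum_map]
    by_cases haX : a ∈ X
    · have h : ∀ b ∈ Z, (insert a {b} ∩ X).card % 2 = if b ∈ X then 0 else 1 := by
        intro b hb
        have hab : a ≠ b := fun h => ha (h ▸ hb)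
        by_cases hbX : b ∈ X <;>
          simp [Finset.insert_inter_of_mem, Finset.singleton_inter_of_mem,
            Finset.singleton_inter_of_notMem, haX, hbX, hab]
      rw [Finset.insert_inter_of_mem haX, Finset.insert_sdiff_of_mem _ haX,
        Finset.card_insert_of_notMem (by simp [ha]), hcardZ']
      simp only [Function.Embedding.coeFn_mk]
      rw [Finset.sum_congr rfl h]
      ring
    · have h : ∀ b ∈ Z, (insert a {b} ∩ X).card % 2 = if b ∈ X then 1 else 0 := by
        intro b hb
        by_cases hbX : b ∈ X <;>
          simp [Finset.insert_inter_of_notMem, Finset.singleton_inter_of_mem,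
            Finset.singleton_inter_of_notMem, haX, hbX]
      rw [Finset.insert_inter_of_notMem haX, Finset.insert_sdiff_of_notMem _ haX,
        Finset.card_insert_of_notMem (by simp [ha]), hcardZ]
      simp only [Function.Embedding.coeFn_mk]
      rw [Finset.sum_congr rfl h]
      ring

/-- With `s = |Z ∩ X|` and `z = |Z|`, the pairs contribute `s (z - s)` and the singletons `7 z s`;
together this is `8 z s - s²`. The factor `7 z` is chosen to cancel the mixed term modulo 8. -/
theorem sum_corrFactor {α : Type*} [DecidableEq α] (Z X : Finset α) :
    ((∑ Y ∈ Z.powerset, corrFactor Y.card Z.card * ((Y ∩ X).card % 2) : ℕ) : ZMod 8) =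
      -((Z ∩ X).card : ZMod 8) ^ 2 := by
  have h1 : ∑ Y ∈ Z.powersetCard 1, (Y ∩ X).card % 2 = (Z ∩ X).card := by
    rw [Finset.powersetCard_one, Finset.sum_map, ← Finset.filter_mem_eq_inter,
      Finset.card_filter]
    refine Finset.sum_congr rfl fun b _ => ?_
    by_cases hbX : b ∈ X <;> simp [Finset.singleton_inter_of_mem,
            Finset.singleton_inter_of_notMem, hbX]
  have h : ∀ Y : Finset α, corrFactor Y.card Z.card * ((Y ∩ X).card % 2) =
      (if Y.card = 1 then 7 * Z.card * ((Y ∩ X).card % 2) else 0) +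
        if Y.card = 2 then (Y ∩ X).card % 2 else 0 := by
    intro Y
    simp only [corrFactor]
    split_ifs <;> simp_all
  simp only [h, Finset.sum_add_distrib, ← Finset.sum_filter, ← Finset.powersetCard_eq_filter,
    ← Finset.mul_sum]
  rw [h1, sum_powersetCard_two_mod_two, ← Finset.card_inter_add_card_sdiff Z X]
  push_cast
  have h8 : (8 : ZMod 8) = 0 := by decide
  linear_combination ((Z ∩ X).card ^ 2 + (Z ∩ X).card * (Z \ X).card : ZMod 8) * h8

/-- Modulo 8 the parity of `s` is `s - 2 C(s,2) + 4 C(s,3)`, whereas `s² = s + 2 C(s,2)`. The proof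
is an induction with Pascal's rule. -/
theorem natCast_mod_two_sub_sq (s : ℕ) :
    ((s % 2 : ℕ) : ZMod 8) - (s : ZMod 8) ^ 2 = 4 * ((s.choose 2 + s.choose 3 : ℕ) : ZMod 8) := by
  have h8 : (8 : ZMod 8) = 0 := by decide
  -- This is twice the congruence `s mod 2 = s - 2 C(s,2)` modulo 4; it accounts for the increment
  -- in the main induction.
  have h4 : ∀ s : ℕ, (2 * (s : ZMod 8) - 2 * (s % 2 : ℕ)) = 4 * (s.choose 2 : ℕ) := by
    intro s
    induction s with
    | zero => simp
    | succ s ih =>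
      rw [Nat.choose_succ_succ' s 1, Nat.choose_one_right]
      rcases Nat.mod_two_eq_zero_or_one s with h | h
      · rw [show (s + 1) % 2 = 1 by omega]
        rw [h] at ih
        obtain ⟨r, hr⟩ : ∃ r, s = 2 * r := ⟨s / 2, by omega⟩
        subst hr
        push_cast at ih ⊢
        linear_combination ih - (r : ZMod 8) * h8
      · rw [show (s + 1) % 2 = 0 by omega]
        rw [h] at ih
        obtain ⟨r, hr⟩ : ∃ r, s = 2 * r + 1 := ⟨s / 2, by omega⟩
        subst hr
        push_cast at ih ⊢
        linear_combination ih - (r : ZMod 8) * h8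
  induction s with
  | zero => simp
  | succ s ih =>
    rw [Nat.choose_succ_succ' s 1, Nat.choose_succ_succ' s 2, Nat.choose_one_right]
    have h4s := h4 s
    have hp : (((s + 1) % 2 : ℕ) : ZMod 8) = 1 - (s % 2 : ℕ) := by
      rcases Nat.mod_two_eq_zero_or_one s with h | h
      · rw [show (s + 1) % 2 = 1 by omega, h]; simp
      · rw [show (s + 1) % 2 = 0 by omega, h]; simp
    rw [hp]
    push_cast at ih ⊢
    linear_combination ih + h4s - (s : ZMod 8) * h8

/-- A one of `w` at a vector with support `Z` contributes `s mod 2` through the lift and `-s²`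
through the correction, so in total 4 times the number of pairs and triples in `Z ∩ X`. Counted by
pairs and triples of `X` instead, each appears an even number of times, so the total is divisible by
8. -/
theorem Word.phasePoly_lift_add_corr {w : Word n} (hw : w ∈ puncturedRM ((n : ℤ) - 4) n) :
    (w.lift + w.corr).phasePoly = 0 := by
  funext x
  set X := supp x
  have hlift : w.lift.phasePoly x =
      ∑ k, ((w k).val : ZMod 8) * (((supp (nonzeroVec n k) ∩ X).card % 2 : ℕ) : ZMod 8) := by
    simp only [Tuple.phasePoly, Word.lift, val_dotProduct, X]
  have hcorr : w.corr.phasePoly x =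
      ∑ k, ((w k).val : ZMod 8) * -((supp (nonzeroVec n k) ∩ X).card : ZMod 8) ^ 2 := by
    simp only [Tuple.phasePoly, Word.corr, val_dotProduct]
    rw [sum_supp_nonzeroVec fun Y => ((∑ k, if Y ⊆ supp (nonzeroVec n k) then
      (w k).val * corrFactor Y.card (supp (nonzeroVec n k)).card else 0 : ℕ) : ZMod 8) *
        (((Y ∩ X).card % 2 : ℕ) : ZMod 8)]
    · simp only [← sum_corrFactor, ← Nat.cast_mul, ← Nat.cast_sum, Finset.sum_mul, Finset.mul_sum]
      rw [Finset.sum_comm]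
      congr 1
      refine Finset.sum_congr rfl fun k _ => ?_
      have hpow : (supp (nonzeroVec n k)).powerset =
          Finset.univ.filter fun Y => Y ⊆ supp (nonzeroVec n k) := by
        ext
        simp
      rw [hpow, Finset.sum_filter]
      refine Finset.sum_congr rfl fun Y _ => ?_
      split_ifs
      · ring
      · simp
    · simp
  rw [Tuple.phasePoly_add, Pi.add_apply, hlift, hcorr, ← Finset.sum_add_distrib]
  have hterm : ∀ k, ((w k).val : ZMod 8) *
      (((supp (nonzeroVec n k) ∩ X).card % 2 : ℕ) : ZMod 8) +
      ((w k).val : ZMod 8) * -((supp (nonzeroVec n k) ∩ X).card : ZMod 8) ^ 2 =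
      4 * (((w k).val * ((supp (nonzeroVec n k) ∩ X).card.choose 2 +
        (supp (nonzeroVec n k) ∩ X).card.choose 3) : ℕ) : ZMod 8) := by
    intro k
    have := natCast_mod_two_sub_sq (supp (nonzeroVec n k) ∩ X).card
    push_cast at this ⊢
    linear_combination ((w k).val : ZMod 8) * this
  -- Double counting of the sets `T` of size `m` inside both `X` and the support of a vector of `w`.
  have hchoose : ∀ m, ∑ k, (w k).val * (supp (nonzeroVec n k) ∩ X).card.choose m =
      ∑ T ∈ X.powersetCard m, countAbove w T := by
    intro m
    simp only [countAbove]
    rw [Finset.sum_comm]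
    refine Finset.sum_congr rfl fun k _ => ?_
    rw [← Finset.sum_filter, Finset.sum_const, smul_eq_mul, mul_comm, ← Finset.card_powersetCard]
    congr 2
    ext T
    simp only [Finset.mem_powersetCard, Finset.mem_filter, Finset.subset_inter_iff]
    tauto
  simp only [hterm, ← Finset.mul_sum, ← Nat.cast_sum, mul_add, Finset.sum_add_distrib, hchoose]
  have heven : Even (∑ T ∈ X.powersetCard 2, countAbove w T +
      ∑ T ∈ X.powersetCard 3, countAbove w T) := by
    refine (Finset.even_sum _ fun T hT => ?_).add (Finset.even_sum _ fun T hT => ?_)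
    · obtain ⟨i, k, -, rfl⟩ := Finset.card_eq_two.1 (Finset.mem_powersetCard.1 hT).2
      have := even_countAbove hw i i k
      rwa [Finset.insert_idem] at this
    · obtain ⟨i, k, l, -, -, -, rfl⟩ := Finset.card_eq_three.1 (Finset.mem_powersetCard.1 hT).2
      exact even_countAbove hw i k l
  obtain ⟨r, hr⟩ := heven
  have h8 : (8 : ZMod 8) = 0 := by decide
  rw [hr, Nat.cast_add, Pi.zero_apply]
  linear_combination (r : ZMod 8) * h8

end

section

/-! ### Programs for binary digits -/

theorem PolyBound.pass {ι : Type} {m N : ι → ℕ} (h : PolyBound m N) :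
    PolyBound (fun p : Ctx.Pass N => m p.1.1) fun p => p.1.2 :=
  (h.comp fun p : Ctx.Pass N => p.1.1).mono fun p => p.2.le

theorem sum_testBit_mul_two_pow {m n : ℕ} (h : m < 2 ^ n) :
    (∑ k ∈ Finset.range n, if m.testBit k then 2 ^ k else 0) = m := by
  suffices H : ∀ n, (∑ k ∈ Finset.range n, if m.testBit k then 2 ^ k else 0) = m % 2 ^ n by
    rw [H, Nat.mod_eq_of_lt h]
  intro n
  induction n with
  | zero => simp [Nat.mod_one]
  | succ n ih =>
    rw [Finset.sum_range_succ, ih, Nat.mod_pow_succ, ← Nat.toNat_testBit]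
    cases m.testBit n <;> simp

/-- This recursion scans the digits upwards and remembers the last position with digit 1; it starts
from `Nat.log2 0 = 0`. -/
theorem log2_mod_two_pow_succ (m k : ℕ) :
    Nat.log2 (m % 2 ^ (k + 1)) = if m / 2 ^ k % 2 = 0 then Nat.log2 (m % 2 ^ k) else k := by
  rw [Nat.mod_pow_succ]
  split_ifs with h
  · rw [h, mul_zero, add_zero]
  · have h1 : m / 2 ^ k % 2 = 1 := by omega
    have h2 : m % 2 ^ k < 2 ^ k := Nat.mod_lt _ (by positivity)
    rw [h1, mul_one, Nat.log2_eq_iff (by positivity)]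
    constructor
    · omega
    · rw [pow_succ]
      omega

variable {ι : Type} {Γ : Ctx ι}

namespace Ctx

variable {n m u v k : ι → ℕ}

theorem Scalar.ite_singleton {p : ι → Prop} [DecidablePred p] (hv : Γ.Scalar m)
    (hu : Γ.Comp fun i => [u i]) (hw : Γ.Comp fun i => [v i]) (hp : ∀ i, p i ↔ m i = 0) :
    Γ.Comp fun i => [if p i then u i else v i] :=
  (hv.ite hu hw hp).congr fun i => by split_ifs <;> rfl

theorem Scalar.shift (hm : Γ.Scalar m) (hk : Γ.Scalar k) (hB : PolyBound Γ.size k) :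
    Γ.Comp fun i => [m i / 2 ^ k i] :=
  Comp.loop (st := fun i j => [m i / 2 ^ j]) hk hB (by simpa using hm.comp)
    ((Var.state _ _ _).scalar.half.comp.congr fun p => by rw [pow_succ, Nat.div_div_eq_div_mul])

theorem Scalar.two_pow (hk : Γ.Scalar k) (hB : PolyBound Γ.size k) :
    Γ.Comp fun i => [2 ^ k i] :=
  Comp.loop (st := fun _ j => [2 ^ j]) hk hB (Scalar.const Γ 1).comp
    (((Var.state _ _ _).scalar.add (Var.state _ _ _).scalar).comp.congr fun p => by
      rw [pow_succ, mul_two])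

theorem Scalar.testBit (hm : Γ.Scalar m) (hk : Γ.Scalar k) (hB : PolyBound Γ.size k) :
    Γ.Comp fun i => [((m i).testBit (k i)).toNat] :=
  ((hm.shift hk hB).bind (Scalar.last _ _).mod_two.comp).congr fun i => by
    rw [Nat.toNat_testBit]

/-- The machine has no bitwise operations, so the result is reassembled from its digits; the bounds
guarantee that `n` digits suffice. -/
theorem Scalar.xor (hu : Γ.Scalar u) (hv : Γ.Scalar v) (hn : Γ.Scalar n)
    (hB : PolyBound Γ.size n) (hun : ∀ i, u i < 2 ^ n i) (hvn : ∀ i, v i < 2 ^ n i) :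
    Γ.Comp fun i => [u i ^^^ v i] := by
  refine (Comp.sum (g := fun i k => if (u i ^^^ v i).testBit k then 2 ^ k else 0) hn hB
    fun st => ?_).congr fun i => by
      rw [sum_testBit_mul_two_pow (Nat.xor_lt_two_pow (hun i) (hvn i))]
  have hp := Scalar.pass Γ n st
  refine ((hu.inLoop n st).testBit hp hB.pass).bind
    ((((hv.inLoop n st).ext _).testBit (hp.ext _) hB.pass).bind
      (Comp.bind (((hp.ext _).ext _).two_pow hB.pass) ?_))
  refine ((((Scalar.last _ _).ext _).ext _).add ((Scalar.last _ _).ext _)).mod_two.ite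
    (Scalar.const _ 0).comp (Scalar.last _ _).comp (fun p => Iff.rfl) |>.congr fun p => ?_
  rw [Nat.testBit_xor]
  cases (u p.1.1).testBit p.1.2 <;> cases (v p.1.1).testBit p.1.2 <;> rfl

theorem Scalar.weight (hm : Γ.Scalar m) (hn : Γ.Scalar n) (hB : PolyBound Γ.size n) :
    Γ.Comp fun i => [∑ k ∈ Finset.range (n i), ((m i).testBit k).toNat] :=
  Comp.sum hn hB fun st => (hm.inLoop n st).testBit (Scalar.pass Γ n st) hB.pass

theorem Scalar.digitExcess (hu : Γ.Scalar u) (hv : Γ.Scalar v) (hn : Γ.Scalar n)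
    (hB : PolyBound Γ.size n) :
    Γ.Comp fun i =>
      [∑ k ∈ Finset.range (n i), (((u i).testBit k).toNat - ((v i).testBit k).toNat)] := by
  refine Comp.sum (g := fun i k => ((u i).testBit k).toNat - ((v i).testBit k).toNat) hn hB
    fun st => ?_
  have hp := Scalar.pass Γ n st
  exact ((hu.inLoop n st).testBit hp hB.pass).bind
    ((((hv.inLoop n st).ext _).testBit (hp.ext _) hB.pass).bind
      (((Scalar.last _ _).ext _).sub (Scalar.last _ _)).comp)

theorem Scalar.log2 (hm : Γ.Scalar m) (hn : Γ.Scalar n) (hB : PolyBound Γ.size n)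
    (hmn : ∀ i, m i < 2 ^ n i) : Γ.Comp fun i => [Nat.log2 (m i)] := by
  refine (Comp.loop (st := fun i k => [Nat.log2 (m i % 2 ^ k)]) hn hB ?_ ?_).congr fun i => by
    rw [Nat.mod_eq_of_lt (hmn i)]
  · exact (Scalar.const Γ 0).comp.congr fun i => by simp [Nat.mod_one]
  · have hp := Scalar.pass Γ n fun i k => [Nat.log2 (m i % 2 ^ k)]
    refine ((hm.inLoop n _).shift hp hB.pass).bind
      (((Scalar.last _ _).mod_two.ite ((Var.state _ _ _).ext _).scalar.comp (hp.ext _).comp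
        fun _ => Iff.rfl).congr fun p => ?_)
    rw [log2_mod_two_pow_succ]
    split_ifs <;> rfl

end Ctx

theorem List.ofFn_natCast_eq_map_range {α : Type} (N : ℕ) (f : ℕ → α) :
    List.ofFn (fun j : Fin N => f j) = (List.range N).map f :=
  List.ext_getElem (by simp) fun j _ _ => by simp

/-! ### A program for the coefficients of a circuit -/

/-- The `e`-th number of the code of the `k`-th gate. -/
def Circuit.code {n : ℕ} (C : Circuit n) (k e : ℕ) : ℕ := (encode C).getD (3 * k + e) 0

theorem Gate.length_encode {n : ℕ} (g : Gate n) : g.encode.length = 3 := by cases g <;> rfl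

namespace Circuit

variable {n : ℕ}

theorem encode_cons (g : Gate n) (C : Circuit n) : encode (g :: C) = g.encode ++ encode C := rfl

theorem encode_append (C D : Circuit n) : encode (C ++ D) = encode C ++ encode D :=
  List.flatMap_append

theorem length_encode (C : Circuit n) : (encode C).length = 3 * C.length := by
  induction C with
  | nil => rfl
  | cons g C ih =>
    rw [encode_cons, List.length_append, ih, g.length_encode, List.length_cons]
    omega

theorem code_cons_zero (g : Gate n) (C : Circuit n) {e : ℕ} (he : e < 3) :
    code (g :: C) 0 e = g.encode.getD e 0 := by
  rw [code, encode_cons, List.getD_append _ _ _ _ (by rw [g.length_encode]; omega)]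
  simp

theorem code_cons_succ (g : Gate n) (C : Circuit n) (k e : ℕ) :
    code (g :: C) (k + 1) e = code C k e := by
  rw [code, encode_cons, List.getD_append_right _ _ _ _ (by rw [g.length_encode]; omega),
    g.length_encode, code]
  congr 1
  omega

/-- The linear forms on the qubits after `k` gates, starting from `r`. -/
def rows (r : ℕ → ℕ) (C : Circuit n) (k : ℕ) : ℕ → ℕ :=
  (C.take k).foldl (fun r g => g.rowStep r) r

theorem goodRows_rows {r : ℕ → ℕ} (hr : GoodRows n r) (C : Circuit n) (k : ℕ) :
    GoodRows n (rows r C k) := by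
  induction C generalizing r k with
  | nil => simpa [rows] using hr
  | cons g C ih =>
    cases k with
    | zero => exact hr
    | succ k => exact ih (hr.rowStep g) k

theorem code_lt (C : Circuit n) {k : ℕ} (hk : k < C.length) :
    code C k 1 < n ∧ code C k 2 < n := by
  induction C generalizing k with
  | nil => simp at hk
  | cons g C ih =>
    cases k with
    | zero =>
      rw [code_cons_zero _ _ (by norm_num), code_cons_zero _ _ (by norm_num)]
      cases g with
      | cnot c t h => exact ⟨c.2, t.2⟩
      -- Diagonal gates pad their code with 0, which is a valid qubit number because some qubit
      -- exists.
      | T q => exact ⟨q.2, q.pos⟩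
      | P q => exact ⟨q.2, q.pos⟩
      | Z q => exact ⟨q.2, q.pos⟩
    | succ k =>
      rw [code_cons_succ, code_cons_succ]
      exact ih (Nat.lt_of_succ_lt_succ hk)

/-- The form with truncated subtraction can be tested by the machine: the sum vanishes exactly when
the gate is a `CNOT` and `q` is its target. -/
theorem rows_succ (r : ℕ → ℕ) (C : Circuit n) {k : ℕ} (hk : k < C.length) (q : ℕ) :
    rows r C (k + 1) q =
      if code C k 0 + ((q - code C k 2) + (code C k 2 - q)) = 0 then
        rows r C k (code C k 2) ^^^ rows r C k (code C k 1) else rows r C k q := by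
  induction C generalizing r k with
  | nil => simp at hk
  | cons g C ih =>
    cases k with
    | zero =>
      rw [code_cons_zero _ _ (by norm_num), code_cons_zero _ _ (by norm_num),
        code_cons_zero _ _ (by norm_num)]
      simp only [rows, List.take_succ_cons, List.take_zero, List.foldl_cons, List.foldl_nil]
      cases g with
      | cnot c t h =>
        simp only [Gate.rowStep, Gate.encode, Function.update_apply, List.getD_cons_zero,
          List.getD_cons_succ]
        congr 1
        rw [eq_iff_iff]
        omega
      | _ => simp [Gate.rowStep, Gate.encode]
    | succ k =>
      rw [code_cons_succ, code_cons_succ, code_cons_succ]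
      exact ih _ (Nat.lt_of_succ_lt_succ hk)

/-- The expression `c + (c - 2)`, with truncated subtraction, sends the gate codes 0, 1, 2, 3 to the
weights 0, 1, 2, 4. -/
theorem coeffSum_eq (r : ℕ → ℕ) (m : ℕ) (C : Circuit n) :
    coeffSum r m C = ∑ k ∈ Finset.range C.length,
      if rows r C k (code C k 1) = m then code C k 0 + (code C k 0 - 2) else 0 := by
  induction C generalizing r with
  | nil => rfl
  | cons g C ih =>
    rw [List.length_cons, Finset.sum_range_succ', coeffSum, ih, add_comm]
    congr 1
    · exact Finset.sum_congr rfl fun k _ => by rw [code_cons_succ, code_cons_succ]; rfl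
    · rw [code_cons_zero _ _ (by norm_num), code_cons_zero _ _ (by norm_num)]
      cases g <;> rfl

theorem encode_cnots (C : Circuit n) : encode (cnots C) =
    (List.range C.length).flatMap fun k =>
      if code C k 0 = 0 then [0, code C k 1, code C k 2] else [] := by
  induction C with
  | nil => rfl
  | cons g C ih =>
    rw [List.length_cons, List.range_succ_eq_map, List.flatMap_cons, List.flatMap_map]
    simp only [code_cons_succ, ← ih]
    rw [code_cons_zero _ _ (by norm_num), code_cons_zero _ _ (by norm_num),
      code_cons_zero _ _ (by norm_num)]
    cases g <;> rfl

theorem encode_coeff (C : Circuit n) : Tuple.encode (coeff C) =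
    (List.range (2 ^ n - 1)).map fun j => coeffSum (fun q => 2 ^ q) (j + 1) C % 8 := by
  rw [← List.ofFn_natCast_eq_map_range, Tuple.encode]
  simp only [coeff, ZMod.val_natCast]

end Circuit

theorem Tuple.getD_encode {n : ℕ} (a : Tuple n) {j : ℕ} (hj : j < 2 ^ n - 1) :
    (Tuple.encode a).getD j 0 = (a ⟨j, hj⟩).val := by
  rw [List.getD_eq_getElem _ _ (by simpa [Tuple.encode] using hj)]
  simp [Tuple.encode]

theorem Word.getD_encode {n : ℕ} (w : Word n) {j : ℕ} (hj : j < 2 ^ n - 1) :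
    (Word.encode w).getD j 0 = (w ⟨j, hj⟩).val := by
  rw [List.getD_eq_getElem _ _ (by simpa [Word.encode] using hj)]
  simp [Word.encode]

theorem Tuple.length_encode {n : ℕ} (a : Tuple n) : (Tuple.encode a).length = 2 ^ n - 1 := by
  simp [Tuple.encode]

theorem Word.length_encode {n : ℕ} (w : Word n) : (Word.encode w).length = 2 ^ n - 1 := by
  simp [Word.encode]

namespace Ctx

variable {n k : ι → ℕ} {C : ∀ i, Circuit (n i)} {c : ℕ}

theorem Var.code (hC : Γ.Var c fun i => Circuit.encode (C i)) (hk : Γ.Scalar k)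
    (hlt : ∀ i, k i < (C i).length) {e : ℕ} (he : e < 3) :
    Γ.Scalar fun i => Circuit.code (C i) (k i) e :=
  hC.get (hk.mul_three.add (.const Γ e)) fun i => by
    rw [Circuit.length_encode]
    have := hlt i
    omega

/-- The length of the code has to be divided by 3, which is done by counting the `k` with `3 * k +
1` at most that length. -/
theorem Var.gateCount (hC : Γ.Var c fun i => Circuit.encode (C i))
    (hCB : PolyBound Γ.size fun i => (Circuit.encode (C i)).length) :
    Γ.Comp fun i => [(C i).length] := by
  refine (Comp.sum (g := fun i k => if 3 * k + 1 - (Circuit.encode (C i)).length = 0 then 1 else 0)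
    hC.length hCB fun st => ?_).congr fun i => ?_
  · exact (((Scalar.pass Γ _ st).mul_three.add (.const _ 1)).sub (hC.length.inLoop _ st)).ite_singleton
      (Scalar.const _ 1).comp (Scalar.const _ 0).comp fun _ => Iff.rfl
  · rw [Finset.sum_boole, Circuit.length_encode]
    have : (Finset.range (3 * (C i).length)).filter
        (fun k => 3 * k + 1 - 3 * (C i).length = 0) = Finset.range (C i).length := by
      ext k
      simp only [Finset.mem_filter, Finset.mem_range]
      omega
    rw [this, Finset.card_range, Nat.cast_id]

theorem Var.rows (hC : Γ.Var c fun i => Circuit.encode (C i)) (hn : Γ.Scalar n)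
    (hnB : PolyBound Γ.size n) (hk : Γ.Scalar k) (hkB : PolyBound Γ.size k)
    (hle : ∀ i, k i ≤ (C i).length) :
    Γ.Comp fun i => (List.range (n i)).map (Circuit.rows (fun q => 2 ^ q) (C i) (k i)) := by
  refine Comp.loop
    (st := fun i k => (List.range (n i)).map (Circuit.rows (fun q => 2 ^ q) (C i) k)) hk hkB
    (Comp.map hn hnB fun st => (Scalar.pass Γ n st).two_pow hnB.pass) ?_
  set st := fun i k => (List.range (n i)).map (Circuit.rows (fun q => 2 ^ q) (C i) k)
  have hlt : ∀ p : Pass k, p.1.2 < (C p.1.1).length := fun p => p.2.trans_le (hle _)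
  have hnB' : PolyBound (Γ.inLoop k st).size fun p => n p.1.1 := hnB.comp _
  refine (Comp.map (g := fun p q => if Circuit.code (C p.1.1) p.1.2 0 +
      ((q - Circuit.code (C p.1.1) p.1.2 2) + (Circuit.code (C p.1.1) p.1.2 2 - q)) = 0 then
        Circuit.rows (fun q => 2 ^ q) (C p.1.1) p.1.2 (Circuit.code (C p.1.1) p.1.2 2) ^^^
        Circuit.rows (fun q => 2 ^ q) (C p.1.1) p.1.2 (Circuit.code (C p.1.1) p.1.2 1)
      else Circuit.rows (fun q => 2 ^ q) (C p.1.1) p.1.2 q) (hn.inLoop k st) hnB'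
      fun st' => ?_).congr fun p => ?_
  · have hcode : ∀ e < 3, ((Γ.inLoop k st).inLoop (fun p => n p.1.1) st').Scalar
        fun p => Circuit.code (C p.1.1.1.1) p.1.1.1.2 e := fun e he =>
      ((hC.inLoop k st).code (Scalar.pass Γ k st) hlt he).inLoop _ st'
    have hrow : ∀ {q : Pass (fun p : Pass k => n p.1.1) → ℕ},
        ((Γ.inLoop k st).inLoop (fun p => n p.1.1) st').Scalar q →
        (∀ p, q p < n p.1.1.1.1) → ((Γ.inLoop k st).inLoop (fun p => n p.1.1) st').Scalar
          fun p => Circuit.rows (fun q => 2 ^ q) (C p.1.1.1.1) p.1.1.1.2 (q p) := by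
      intro q hq hqn
      refine (((Var.state Γ k st).inLoop (fun p => n p.1.1) st').get hq fun p => ?_).congr
        fun p => ?_
      · simpa [st] using hqn p
      · rw [List.getD_eq_getElem _ _ (by simpa [st] using hqn p)]
        simp [st]
    have hq := Scalar.pass (Γ.inLoop k st) (fun p => n p.1.1) st'
    have h1 := fun p : Pass fun p : Pass k => n p.1.1 => (Circuit.code_lt _ (hlt p.1.1)).1
    have h2 := fun p : Pass fun p : Pass k => n p.1.1 => (Circuit.code_lt _ (hlt p.1.1)).2
    have hgood := fun p : Pass fun p : Pass k => n p.1.1 =>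
      (Circuit.goodRows_rows (goodRows_two_pow (n p.1.1.1.1)) (C p.1.1.1.1) p.1.1.1.2).1
    exact ((hcode 0 (by norm_num)).add ((hq.sub (hcode 2 (by norm_num))).add
      ((hcode 2 (by norm_num)).sub hq))).ite_singleton (Scalar.xor (hrow (hcode 2 (by norm_num)) h2)
        (hrow (hcode 1 (by norm_num)) h1) ((hn.inLoop k st).inLoop _ st') (hnB'.comp _)
        (fun p => hgood p _ (h2 p)) fun p => hgood p _ (h1 p)) (hrow hq fun p => p.2).comp
        fun p => Iff.rfl
  · exact List.map_congr_left fun q _ => (Circuit.rows_succ _ _ (hlt p) q).symm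

/-- The linear forms are recomputed from the start for every coefficient and every gate. This is
wasteful but polynomial, and it avoids carrying them along as part of a loop state. -/
theorem Var.coeff (hC : Γ.Var c fun i => Circuit.encode (C i))
    (hCB : PolyBound Γ.size fun i => (Circuit.encode (C i)).length) (hn : Γ.Scalar n)
    (hnB : PolyBound Γ.size n) (hpB : PolyBound Γ.size fun i => 2 ^ n i) :
    Γ.Comp fun i => Tuple.encode (Circuit.coeff (C i)) := by
  refine ((hn.two_pow hnB).bind (((hC.ext _).gateCount hCB).bind ?_)).congr fun i =>
    (Circuit.encode_coeff (C i)).symm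
  set Δ := (Γ.ext fun i => [2 ^ n i]).ext fun i => [(C i).length]
  have hC := (hC.ext fun i => [2 ^ n i]).ext fun i => [(C i).length]
  have hn := (hn.ext fun i => [2 ^ n i]).ext fun i => [(C i).length]
  have hL : Δ.Scalar fun i => (C i).length := Scalar.last _ _
  have hLB : PolyBound Δ.size fun i => (C i).length :=
    PolyBound.mono hCB fun i => by rw [Circuit.length_encode]; omega
  have hN : Δ.Scalar fun i => 2 ^ n i - 1 := ((Scalar.last _ _).ext _).sub (.const _ 1)
  have hNB : PolyBound Δ.size fun i => 2 ^ n i - 1 := PolyBound.mono hpB fun i => Nat.sub_le _ _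
  have hnB : PolyBound Δ.size n := hnB
  refine Comp.map hN hNB fun st => ?_
  simp only [Circuit.coeffSum_eq]
  refine (Comp.sum (g := fun p k => if Circuit.rows (fun q => 2 ^ q) (C p.1.1) k
      (Circuit.code (C p.1.1) k 1) = p.1.2 + 1 then
        Circuit.code (C p.1.1) k 0 + (Circuit.code (C p.1.1) k 0 - 2) else 0)
      (hL.inLoop _ st) (hLB.comp _) fun st' => ?_).bind (Scalar.last _ _).mod_eight.comp
  have hk := Scalar.pass (Δ.inLoop _ st) (fun p => (C p.1.1).length) st'
  have hC' := (hC.inLoop _ st).inLoop (fun p => (C p.1.1).length) st'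
  have hlt : ∀ p : Pass fun p : Pass fun i => 2 ^ n i - 1 => (C p.1.1).length,
      p.1.2 < (C p.1.1.1.1).length := fun p => p.2
  have hrows := hC'.rows ((hn.inLoop _ st).inLoop _ st') ((hnB.comp _).comp _) hk
    (PolyBound.pass (hLB.comp _)) fun p => (hlt p).le
  refine hrows.bind ?_
  have hj := ((Scalar.pass Δ _ st).inLoop (fun p => (C p.1.1).length) st').ext fun p =>
    (List.range (n p.1.1.1.1)).map (Circuit.rows (fun q => 2 ^ q) (C p.1.1.1.1) p.1.2)
  have hop := (hC'.code hk hlt (show 0 < 3 by norm_num)).ext fun p =>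
    (List.range (n p.1.1.1.1)).map (Circuit.rows (fun q => 2 ^ q) (C p.1.1.1.1) p.1.2)
  have hr := (Var.last ((Δ.inLoop _ st).inLoop (fun p => (C p.1.1).length) st') fun p =>
    (List.range (n p.1.1.1.1)).map (Circuit.rows (fun q => 2 ^ q) (C p.1.1.1.1) p.1.2)).get
      ((hC'.code hk hlt (show 1 < 3 by norm_num)).ext _) fun p => by
        simpa using (Circuit.code_lt _ (hlt p)).1
  have hj1 := hj.add (.const _ 1)
  refine ((hr.sub hj1).add (hj1.sub hr)).ite_singleton (hop.add (hop.sub (.const _ 2))).comp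
    (Scalar.const _ 0).comp fun p => ?_
  rw [List.getD_eq_getElem _ _ (by simpa using (Circuit.code_lt _ (hlt p)).1)]
  simp only [List.getElem_map, List.getElem_range]
  omega

theorem Var.cnots (hC : Γ.Var c fun i => Circuit.encode (C i))
    (hCB : PolyBound Γ.size fun i => (Circuit.encode (C i)).length) :
    Γ.Comp fun i => Circuit.encode (Circuit.cnots (C i)) := by
  refine ((hC.gateCount hCB).bind (Comp.flatMap (N := fun i => (C i).length)
    (g := fun i k => if Circuit.code (C i) k 0 = 0 then
      [0, Circuit.code (C i) k 1, Circuit.code (C i) k 2] else [])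
    (Scalar.last _ _) (PolyBound.mono hCB fun i => by rw [Circuit.length_encode]; omega) ?_)).congr
    fun i => (Circuit.encode_cnots (C i)).symm
  have hk := Scalar.pass (Γ.ext fun i => [(C i).length]) (fun i => (C i).length)
    fun i k => (List.range k).flatMap fun k => if Circuit.code (C i) k 0 = 0 then
      [0, Circuit.code (C i) k 1, Circuit.code (C i) k 2] else []
  have hC' := (hC.ext fun i => [(C i).length]).inLoop (fun i => (C i).length)
    fun i k => (List.range k).flatMap fun k => if Circuit.code (C i) k 0 = 0 then
      [0, Circuit.code (C i) k 1, Circuit.code (C i) k 2] else []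
  have hlt : ∀ p : Pass fun i => (C i).length, p.1.2 < (C p.1.1).length := fun p => p.2
  exact (hC'.code hk hlt (by norm_num)).ite (Comp.scalars_three (.const _ 0)
    (hC'.code hk hlt (by norm_num)) (hC'.code hk hlt (by norm_num))) (.nil _) fun _ => Iff.rfl

end Ctx

end

section

/-! ### A program for the circuit of a tuple -/

theorem List.flatMap_finRange_natCast {α : Type} (n : ℕ) (f : ℕ → List α) :
    ((List.finRange n).flatMap fun k : Fin n => f k) = (List.range n).flatMap f := by
  rw [← List.map_coe_finRange_eq_range, List.flatMap_map]

/-- The code of `ladder`. -/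
def ladderCode (n m t : ℕ) : List ℕ :=
  (List.range n).flatMap fun k =>
    if (k - t) + (t - k) = 0 then [] else if 1 - (m.testBit k).toNat = 0 then [0, k, t] else []

/-- The code of `phaseGates`. -/
def phaseCode (t v : ℕ) : List ℕ :=
  (if v % 2 = 0 then [] else [1, t, 0]) ++
    ((if v / 2 % 2 = 0 then [] else [2, t, 0]) ++ if v / 2 / 2 % 2 = 0 then [] else [3, t, 0])

/-- The code of `termCircuit`. -/
def termCode (n j v : ℕ) : List ℕ :=
  ladderCode n (j + 1) (Nat.log2 (j + 1)) ++
    (phaseCode (Nat.log2 (j + 1)) v ++ ladderCode n (j + 1) (Nat.log2 (j + 1)))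

theorem encode_ladder {n : ℕ} (m : ℕ) (t : Fin n) :
    Circuit.encode (ladder m t (List.finRange n)) = ladderCode n m t := by
  rw [Circuit.encode, ladder, List.flatMap_assoc, ladderCode, ← List.flatMap_finRange_natCast]
  refine List.flatMap_congr fun k _ => ?_
  by_cases h : k = t
  · simp [h]
  · have h' : ((k : ℕ) - t) + (t - k) ≠ 0 := fun h0 => h (Fin.ext (by omega))
    rw [dif_pos h, if_neg h']
    cases m.testBit k <;> simp [Gate.encode]

theorem encode_phaseGates {n : ℕ} (t : Fin n) (v : ℕ) :
    Circuit.encode (phaseGates t v) = phaseCode t v := by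
  simp only [phaseGates, phaseCode, Circuit.encode_append]
  split_ifs <;> rfl

theorem encode_synth {n : ℕ} (a : Tuple n) : Circuit.encode a.synth =
    (List.range (2 ^ n - 1)).flatMap fun j => termCode n j ((Tuple.encode a).getD j 0) := by
  rw [← List.flatMap_finRange_natCast, Circuit.encode, Tuple.synth, List.flatMap_assoc]
  refine List.flatMap_congr fun j _ => ?_
  have h : List.flatMap Gate.encode (termCircuit j (a j).val) =
      Circuit.encode (termCircuit j (a j).val) := rfl
  rw [h, termCircuit, Circuit.encode_append, Circuit.encode_append, encode_ladder,
    encode_phaseGates, Tuple.getD_encode a j.2]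
  rfl

theorem Word.encode_lift {n : ℕ} (w : Word n) : Tuple.encode w.lift = Word.encode w := by
  refine congrArg List.ofFn (funext fun j => ?_)
  rw [Word.lift, ZMod.val_natCast, Nat.mod_eq_of_lt ((ZMod.val_lt _).trans (by norm_num))]

variable {ι : Type} {Γ : Ctx ι}

namespace Ctx

variable {n m t v : ι → ℕ} {k : ℕ}

theorem Scalar.ladder (hn : Γ.Scalar n) (hnB : PolyBound Γ.size n) (hm : Γ.Scalar m)
    (ht : Γ.Scalar t) : Γ.Comp fun i => ladderCode (n i) (m i) (t i) := by
  refine Comp.flatMap (g := fun i k => if (k - t i) + (t i - k) = 0 then [] else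
    if 1 - ((m i).testBit k).toNat = 0 then [0, k, t i] else []) hn hnB ?_
  set st := fun i k => (List.range k).flatMap fun k => if (k - t i) + (t i - k) = 0 then [] else
    if 1 - ((m i).testBit k).toNat = 0 then [0, k, t i] else []
  have hk := Scalar.pass Γ n st
  have ht := ht.inLoop n st
  refine ((hm.inLoop n st).testBit hk hnB.pass).bind ?_
  exact (((hk.sub ht).add (ht.sub hk)).ext _).ite (.nil _) (((Scalar.const _ 1).sub
    (Scalar.last _ _)).ite (Comp.scalars_three (.const _ 0) (hk.ext _) (ht.ext _)) (.nil _)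
    fun _ => Iff.rfl) fun _ => Iff.rfl

theorem Scalar.phaseCode (ht : Γ.Scalar t) (hv : Γ.Scalar v) :
    Γ.Comp fun i => phaseCode (t i) (v i) := by
  have hgate : ∀ {Δ : Ctx ι} {b : ι → ℕ} (c : ℕ), Δ.Scalar b → Δ.Scalar t →
      Δ.Comp fun i => if b i % 2 = 0 then [] else [c, t i, 0] := fun c hb ht =>
    hb.mod_two.ite (.nil _) (Comp.scalars_three (.const _ c) ht (.const _ 0)) fun _ => Iff.rfl
  exact (hgate 1 hv ht).append fun _ => (hgate 2 (hv.ext _).half (ht.ext _)).append fun _ =>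
    hgate 3 ((hv.ext _).ext _).half.half ((ht.ext _).ext _)

theorem Var.synth {A : ∀ i, Tuple (n i)} (hA : Γ.Var k fun i => Tuple.encode (A i))
    (hn : Γ.Scalar n) (hnB : PolyBound Γ.size n) (hpB : PolyBound Γ.size fun i => 2 ^ n i) :
    Γ.Comp fun i => Circuit.encode (A i).synth := by
  refine ((hn.two_pow hnB).bind (Comp.flatMap (N := fun i => 2 ^ n i - 1)
    (g := fun i j => termCode (n i) j ((Tuple.encode (A i)).getD j 0))
    ((Scalar.last _ _).sub (.const _ 1)) (hpB.mono fun i => Nat.sub_le _ _) ?_)).congr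
    fun i => (encode_synth (A i)).symm
  set N := fun i => 2 ^ n i - 1
  set st := fun i k => (List.range k).flatMap fun j =>
    termCode (n i) j ((Tuple.encode (A i)).getD j 0)
  have hn' := (hn.ext fun i => [2 ^ n i]).inLoop N st
  have hj := Scalar.pass (Γ.ext fun i => [2 ^ n i]) N st
  have hlt : ∀ p : Pass N, p.1.2 < 2 ^ n p.1.1 - 1 := fun p => p.2
  have hv := ((hA.ext fun i => [2 ^ n i]).inLoop N st).get hj fun p => by
    rw [Tuple.length_encode]
    exact hlt p
  have hnB' : PolyBound ((Γ.ext fun i => [2 ^ n i]).inLoop N st).size fun p => n p.1.1 :=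
    hnB.comp _
  have hm := hj.add (.const _ 1)
  refine (hm.log2 hn' hnB' fun p => ?_).bind ?_
  · have := hlt p
    omega
  have ht := Scalar.last ((Γ.ext fun i => [2 ^ n i]).inLoop N st) fun p => Nat.log2 (p.1.2 + 1)
  have hL := (hn'.ext _).ladder hnB' (hm.ext _) ht
  -- The ladder is computed once and its list is used on both sides of the phase gates.
  refine hL.bind ?_
  refine Comp.append ((Var.last _ _).comp hL.length_polyBound) fun _ => (((ht.ext _).ext _).phaseCode (((hv.ext _).ext _).ext _)).append
    fun _ => ?_
  exact (((Var.last _ _).ext _).ext _).comp hL.length_polyBound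

end Ctx

/-! ### A program for the corrected tuple -/

/-- The number of ones among the first `n` digits. -/
def digitWeight (n m : ℕ) : ℕ := ∑ k ∈ Finset.range n, (m.testBit k).toNat

/-- The number of the first `n` digits that are one in `u` and zero in `v`. -/
def digitExcess (n u v : ℕ) : ℕ :=
  ∑ k ∈ Finset.range n, ((u.testBit k).toNat - (v.testBit k).toNat)

theorem card_supp_toBits (n m : ℕ) : (supp (toBits n m)).card = digitWeight n m := by
  rw [digitWeight, Finset.sum_range, supp, Finset.card_filter]
  refine Finset.sum_congr rfl fun i _ => ?_
  by_cases h : m.testBit i <;> simp [toBits, h]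

theorem supp_toBits_subset_iff (n u v : ℕ) :
    supp (toBits n u) ⊆ supp (toBits n v) ↔ digitExcess n u v = 0 := by
  rw [digitExcess, Finset.sum_range, Finset.sum_eq_zero_iff]
  simp only [Finset.subset_iff, mem_supp, Finset.mem_univ, true_imp_iff, toBits]
  refine forall_congr' fun i => ?_
  cases u.testBit i <;> cases v.testBit i <;> simp

/-- The correction at the vector `y` for the word `w`. -/
def corrSum (n y : ℕ) (w : List ℕ) : ℕ :=
  ∑ k ∈ Finset.range (2 ^ n - 1), if digitExcess n y (k + 1) + (1 - w.getD k 0) = 0 then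
    corrFactor (digitWeight n y) (digitWeight n (k + 1)) else 0

/-- The tuple `a`, changed modulo `2` by a codeword `w` without a change of the phase. -/
def Tuple.shift {n : ℕ} (a : Tuple n) (w : Word n) : Tuple n := a + (w.lift + w.corr)

theorem Tuple.encode_shift {n : ℕ} (a : Tuple n) (w : Word n) : Tuple.encode (a.shift w) =
    (List.range (2 ^ n - 1)).map fun j =>
      ((Tuple.encode a).getD j 0 + (Word.encode w).getD j 0 +
        corrSum n (j + 1) (Word.encode w)) % 8 := by
  rw [← List.ofFn_natCast_eq_map_range]
  refine congrArg List.ofFn (funext fun j => ?_)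
  rw [Tuple.getD_encode a j.2, Word.getD_encode w j.2, corrSum, Finset.sum_range, ← ZMod.val_natCast]
  congr 1
  -- A letter of `w` is 0 or 1, so multiplication by it is replaced by the test `1 - w = 0`, which
  -- the machine can perform.
  have hsum : (∑ k : Fin (2 ^ n - 1),
      if digitExcess n (j + 1) (k + 1) + (1 - (Word.encode w).getD k 0) = 0 then
        corrFactor (digitWeight n (j + 1)) (digitWeight n (k + 1)) else 0) =
      ∑ k, if supp (nonzeroVec n j) ⊆ supp (nonzeroVec n k) then
        (w k).val * corrFactor (supp (nonzeroVec n j)).card (supp (nonzeroVec n k)).card else 0 := by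
    refine Finset.sum_congr rfl fun k _ => ?_
    rw [Word.getD_encode w k.2, Fin.eta, nonzeroVec_apply, nonzeroVec_apply,
      card_supp_toBits, card_supp_toBits]
    simp only [supp_toBits_subset_iff]
    have hw : (w k).val = 0 ∨ (w k).val = 1 := by have := ZMod.val_lt (w k); omega
    rcases hw with h | h <;> simp [h]
  rw [hsum]
  simp only [Tuple.shift, Pi.add_apply, Word.lift, Word.corr, Nat.cast_add,
    ZMod.natCast_zmod_val, Fin.eta, add_assoc]

namespace Ctx

variable {n : ι → ℕ} {k l c : ℕ}

theorem Var.corrSum {w : ∀ i, Word (n i)} {y : ι → ℕ}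
    (hw : Γ.Var l fun i => Word.encode (w i)) (hy : Γ.Scalar y)
    (hn : Γ.Scalar n) (hnB : PolyBound Γ.size n) (hpB : PolyBound Γ.size fun i => 2 ^ n i) :
    Γ.Comp fun i => [corrSum (n i) (y i) (Word.encode (w i))] := by
  have hNB : PolyBound Γ.size fun i => 2 ^ n i - 1 := hpB.mono fun i => Nat.sub_le _ _
  have hN : Γ.Scalar fun i => 2 ^ n i - 1 := hw.length.congr fun i => Word.length_encode _
  refine (hy.weight hn hnB).bind (Comp.sum (N := fun i => 2 ^ n i - 1)
    (g := fun i k => if digitExcess (n i) (y i) (k + 1) + (1 - (Word.encode (w i)).getD k 0) = 0 then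
      corrFactor (digitWeight (n i) (y i)) (digitWeight (n i) (k + 1)) else 0)
    (hN.ext _) hNB fun st => ?_)
  have hk1 := (Scalar.pass (Γ.ext fun i => [digitWeight (n i) (y i)])
    (fun i => 2 ^ n i - 1) st).add (.const _ 1)
  have hn' := (hn.ext fun i => [digitWeight (n i) (y i)]).inLoop (fun i => 2 ^ n i - 1) st
  have hnB' : PolyBound ((Γ.ext fun i => [digitWeight (n i) (y i)]).inLoop
    (fun i => 2 ^ n i - 1) st).size fun p => n p.1.1 := hnB.comp _
  have hwy := (Scalar.last Γ fun i => digitWeight (n i) (y i)).inLoop (fun i => 2 ^ n i - 1) st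
  have hwk := ((hw.ext fun i => [digitWeight (n i) (y i)]).inLoop (fun i => 2 ^ n i - 1) st).get
    (Scalar.pass _ _ st) fun p => by
      rw [Word.length_encode]
      exact p.2
  refine (Scalar.digitExcess ((hy.ext _).inLoop _ st) hk1 hn' hnB').bind
    ((Scalar.weight (hk1.ext _) (hn'.ext _) hnB').bind ?_)
  have hy' := (hwy.ext fun p => [digitExcess (n p.1.1) (y p.1.1) (p.1.2 + 1)]).ext
    fun p => [digitWeight (n p.1.1) (p.1.2 + 1)]
  refine (((Scalar.last _ _).ext _).add ((Scalar.const _ 1).sub ((hwk.ext _).ext _))).ite_singleton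
    (((hy'.sub (.const _ 1)).add ((Scalar.const _ 1).sub hy')).ite_singleton
      (Scalar.last _ _).mul_seven.comp
      (((hy'.sub (.const _ 2)).add ((Scalar.const _ 2).sub hy')).ite_singleton
        (Scalar.const _ 1).comp (Scalar.const _ 0).comp
        fun p => ?_) fun p => ?_) (Scalar.const _ 0).comp fun p => Iff.rfl
  · omega
  · omega

theorem Var.shift {A : ∀ i, Tuple (n i)} {w : ∀ i, Word (n i)}
    (hA : Γ.Var k fun i => Tuple.encode (A i)) (hw : Γ.Var l fun i => Word.encode (w i))
    (hn : Γ.Scalar n) (hnB : PolyBound Γ.size n) (hpB : PolyBound Γ.size fun i => 2 ^ n i) :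
    Γ.Comp fun i => Tuple.encode ((A i).shift (w i)) := by
  have hNB : PolyBound Γ.size fun i => 2 ^ n i - 1 := hpB.mono fun i => Nat.sub_le _ _
  have hN : Γ.Scalar fun i => 2 ^ n i - 1 := hA.length.congr fun i => Tuple.length_encode _
  refine (Comp.map hN hNB fun st => ?_).congr fun i => (Tuple.encode_shift _ _).symm
  have hj := Scalar.pass Γ (fun i => 2 ^ n i - 1) st
  have ha := (hA.inLoop (fun i => 2 ^ n i - 1) st).get hj fun p => by
    rw [Tuple.length_encode]
    exact p.2
  have hx := (hw.inLoop (fun i => 2 ^ n i - 1) st).get hj fun p => by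
    rw [Word.length_encode]
    exact p.2
  exact ((hw.inLoop _ st).corrSum (hj.add (.const _ 1)) (hn.inLoop _ st) (hnB.comp _)
    (hpB.comp fun p : Pass fun i => 2 ^ n i - 1 => p.1.1)).bind
      (((ha.add hx).ext _).add (Scalar.last _ _)).mod_eight.comp

variable {C : ∀ i, Circuit (n i)}

theorem Var.res_coeff (hC : Γ.Var c fun i => Circuit.encode (C i))
    (hCB : PolyBound Γ.size fun i => (Circuit.encode (C i)).length) (hn : Γ.Scalar n)
    (hnB : PolyBound Γ.size n) (hpB : PolyBound Γ.size fun i => 2 ^ n i) :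
    Γ.Comp fun i => Word.encode (Circuit.coeff (C i)).res := by
  have hNB : PolyBound Γ.size fun i => 2 ^ n i - 1 := hpB.mono fun i => Nat.sub_le _ _
  refine ((hC.coeff hCB hn hnB hpB).bind (Comp.map (N := fun i => 2 ^ n i - 1)
    (g := fun i j => (Tuple.encode (Circuit.coeff (C i))).getD j 0 % 2)
    ((Var.last _ _).length.congr fun i => Tuple.length_encode _) hNB fun st => ?_)).congr
    fun i => ?_
  · exact (((Var.last _ _).inLoop _ st).get (Scalar.pass _ _ st) fun p => by
      rw [Tuple.length_encode]
      exact p.2).mod_two.comp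
  · rw [← List.ofFn_natCast_eq_map_range]
    refine congrArg List.ofFn (funext fun j => ?_)
    rw [Tuple.getD_encode _ j.2, Tuple.res, ZMod.val_natCast]

theorem Var.add_res_coeff {w : ∀ i, Word (n i)} (hw : Γ.Var l fun i => Word.encode (w i))
    (hC : Γ.Var c fun i => Circuit.encode (C i))
    (hCB : PolyBound Γ.size fun i => (Circuit.encode (C i)).length) (hn : Γ.Scalar n)
    (hnB : PolyBound Γ.size n) (hpB : PolyBound Γ.size fun i => 2 ^ n i) :
    Γ.Comp fun i => Word.encode fun j => w i j + (Circuit.coeff (C i)).res j := by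
  have hNB : PolyBound Γ.size fun i => 2 ^ n i - 1 := hpB.mono fun i => Nat.sub_le _ _
  refine ((hC.res_coeff hCB hn hnB hpB).bind (Comp.map (N := fun i => 2 ^ n i - 1)
    (g := fun i j => ((Word.encode (w i)).getD j 0 +
      (Word.encode (Circuit.coeff (C i)).res).getD j 0) % 2)
    ((Var.last _ _).length.congr fun i => Word.length_encode _) hNB fun st => ?_)).congr
    fun i => ?_
  · exact ((((hw.ext _).inLoop _ st).get (Scalar.pass _ _ st) fun p => by
      rw [Word.length_encode]
      exact p.2).add (((Var.last _ _).inLoop _ st).get (Scalar.pass _ _ st) fun p => by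
      rw [Word.length_encode]
      exact p.2)).mod_two.comp
  · rw [← List.ofFn_natCast_eq_map_range]
    refine congrArg List.ofFn (funext fun j => ?_)
    rw [Word.getD_encode _ j.2, Word.getD_encode _ j.2, ← ZMod.val_add]

end Ctx

/-- A circuit that is equivalent to `C`, for a codeword `w`. -/
def Circuit.recode {n : ℕ} (C : Circuit n) (w : Word n) : Circuit n :=
  ((coeff C).shift w).synth ++ cnots C

theorem Ctx.Var.recode {n : ι → ℕ} {l c : ℕ} {C : ∀ i, Circuit (n i)} {w : ∀ i, Word (n i)}
    (hC : Γ.Var c fun i => Circuit.encode (C i)) (hw : Γ.Var l fun i => Word.encode (w i))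
    (hCB : PolyBound Γ.size fun i => (Circuit.encode (C i)).length) (hn : Γ.Scalar n)
    (hnB : PolyBound Γ.size n) (hpB : PolyBound Γ.size fun i => 2 ^ n i) :
    Γ.Comp fun i => Circuit.encode (Circuit.recode (C i) (w i)) := by
  refine ((hC.coeff hCB hn hnB hpB).bind (((Var.last _ _).shift (hw.ext _) (hn.ext _) hnB
    hpB).bind (((Var.last _ _).synth ((hn.ext _).ext _) hnB hpB).append fun _ =>
      Var.cnots (((hC.ext _).ext _).ext _) hCB))).congr fun i => ?_
  exact (Circuit.encode_append _ _).symm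

/-! ### The reductions -/

section

variable {n : ℕ}

theorem Tuple.phasePoly_shift (a : Tuple n) {w : Word n}
    (hw : w ∈ puncturedRM ((n : ℤ) - 4) n) : (a.shift w).phasePoly = a.phasePoly := by
  rw [Tuple.shift, Tuple.phasePoly_add, Word.phasePoly_lift_add_corr hw, add_zero]

theorem Tuple.oddCount_shift (a : Tuple n) {w : Word n}
    (hw : w ∈ puncturedRM ((n : ℤ) - 4) n) : (a.shift w).oddCount = hammingDist a.res w := by
  rw [Tuple.oddCount_eq, hammingDist_eq_hammingNorm_add, Tuple.shift, Tuple.res_add,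
    Tuple.res_add, Word.res_lift, Word.res_corr hw, add_zero]

theorem Circuit.unitary_synth_append_cnots {C : Circuit n} {a : Tuple n}
    (ha : a.phasePoly = phase C) : unitary (a.synth ++ cnots C) = unitary C := by
  rw [unitary_eq_iff]
  constructor
  · funext x
    rw [act_append, a.act_synth, act_cnots]
  · funext x
    rw [phase_append, phase_of_cnots fun g => isCnot_of_mem_cnots, a.phase_synth, ha, add_zero]

theorem Circuit.tCount_synth_append_cnots (C : Circuit n) (a : Tuple n) :
    tCount (a.synth ++ cnots C) = a.oddCount := by
  rw [tCount_append, tCount_of_cnots fun g => isCnot_of_mem_cnots, a.tCount_synth, add_zero]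

theorem Circuit.unitary_recode (C : Circuit n) {w : Word n}
    (hw : w ∈ puncturedRM ((n : ℤ) - 4) n) : unitary (recode C w) = unitary C :=
  unitary_synth_append_cnots (by rw [Tuple.phasePoly_shift _ hw, phasePoly_coeff])

theorem Circuit.tCount_recode (C : Circuit n) {w : Word n}
    (hw : w ∈ puncturedRM ((n : ℤ) - 4) n) :
    tCount (recode C w) = hammingDist (coeff C).res w := by
  rw [recode, tCount_synth_append_cnots, Tuple.oddCount_shift _ hw]

/-- The difference of the two tuples has a vanishing phase polynomial, and in characteristic 2 the
difference of the residues is their sum. -/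
theorem Tuple.add_res_mem_puncturedRM {a b : Tuple n} (h : a.phasePoly = b.phasePoly) :
    a.res + b.res ∈ puncturedRM ((n : ℤ) - 4) n := by
  have h' := Tuple.res_mem_puncturedRM (a := a - b) (by rw [Tuple.phasePoly_sub, h, sub_self])
  rwa [Tuple.res_sub, show a.res - b.res = a.res + b.res from
    funext fun j => by rw [Pi.sub_apply, Pi.add_apply, CharTwo.sub_eq_add]] at h'

theorem hammingDist_add_self (x y : Word n) : hammingDist x (x + y) = hammingNorm y := by
  rw [hammingDist_eq_hammingNorm_add]
  congr 1
  funext j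
  rw [Pi.add_apply, Pi.add_apply, ← add_assoc, CharTwo.add_self_eq_zero, zero_add]

/-- An equivalent circuit `E` has coefficients with the same phase polynomial, so its residue
differs from that of `C` by a codeword. The distance of this codeword from the residue of `C` is the
number of odd coefficients of `E`, hence at most its `T`-count. -/
theorem isSol_recode {C : Circuit n} {w : Word n}
    (h : (minDistDecoding fun n => puncturedRM ((n : ℤ) - 4) n).IsSol n (Circuit.coeff C).res w) :
    tCountMinimization.IsSol n C (Circuit.recode C w) := by
  obtain ⟨hw, hmin⟩ := h
  refine ⟨Circuit.unitary_recode C hw, fun E hE => ?_⟩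
  rw [Circuit.tCount_recode C hw]
  have hph : (Circuit.coeff C).phasePoly = (Circuit.coeff E).phasePoly := by
    rw [Circuit.phasePoly_coeff, Circuit.phasePoly_coeff, (Circuit.unitary_eq_iff.1 hE).2]
  refine (hmin _ (Tuple.add_res_mem_puncturedRM hph)).trans ?_
  rw [hammingDist_add_self, ← Tuple.oddCount_eq]
  exact Circuit.oddCount_coeff_le E

/-- Every codeword `z` yields a competitor of `D`: shifting the lift of `x` by `z` keeps the phase,
and the resulting circuit has `T`-count `hammingDist x z`. On the other side, the proposed codeword
is at distance at most the `T`-count of `D`. -/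
theorem isSol_add_res_coeff {x : Word n} {D : Circuit n}
    (h : tCountMinimization.IsSol n x.lift.synth D) :
    (minDistDecoding fun n => puncturedRM ((n : ℤ) - 4) n).IsSol n x
      fun j => x j + (Circuit.coeff D).res j := by
  obtain ⟨hD, hmin⟩ := h
  have hph : x.lift.phasePoly = (Circuit.coeff D).phasePoly := by
    rw [Circuit.phasePoly_coeff, (Circuit.unitary_eq_iff.1 hD).2, Tuple.phase_synth]
  have hmem := Tuple.add_res_mem_puncturedRM hph
  rw [Word.res_lift] at hmem
  refine ⟨hmem, fun z hz => ?_⟩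
  have h1 := hmin (x.lift.shift z).synth (by
    rw [Tuple.unitary_synth, Tuple.unitary_synth, Tuple.phaseOperator_eq, Tuple.phaseOperator_eq,
      Tuple.phasePoly_shift _ hz])
  rw [Tuple.tCount_synth, Tuple.oddCount_shift _ hz, Word.res_lift] at h1
  refine (le_of_eq ?_).trans ((Circuit.oddCount_coeff_le D).trans h1)
  rw [Tuple.oddCount_eq]
  exact hammingDist_add_self _ _

/-- The two sets need not be equal, since a circuit may waste `T` gates. One contains the other, and
each of its elements is bounded below by an element of the smaller set, so they have the same least
elements. -/
theorem isLeast_tCount_iff (C : Circuit n) (k : ℕ) :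
    IsLeast {m | ∃ D : Circuit n, Circuit.unitary D = Circuit.unitary C ∧
        Circuit.tCount D = m} k ↔
      IsLeast {m | ∃ a : Tuple n, Implements a C ∧ Tuple.oddCount a = m} k := by
  set S := {m | ∃ D : Circuit n, Circuit.unitary D = Circuit.unitary C ∧ Circuit.tCount D = m}
  set S' := {m | ∃ a : Tuple n, Implements a C ∧ Tuple.oddCount a = m}
  have h1 : S' ⊆ S := by
    rintro m ⟨a, ha, rfl⟩
    exact ⟨_, Circuit.unitary_synth_append_cnots (implements_iff.1 ha),
      Circuit.tCount_synth_append_cnots C a⟩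
  have h2 : ∀ m ∈ S, ∃ m' ∈ S', m' ≤ m := by
    rintro m ⟨D, hD, rfl⟩
    refine ⟨_, ⟨Circuit.coeff D, implements_iff.2 ?_, rfl⟩, Circuit.oddCount_coeff_le D⟩
    rw [Circuit.phasePoly_coeff, (Circuit.unitary_eq_iff.1 hD).2]
  constructor
  · rintro ⟨hk, hmin⟩
    obtain ⟨m, hm, hmk⟩ := h2 k hk
    obtain rfl : m = k := le_antisymm hmk (hmin (h1 hm))
    exact ⟨hm, fun m' hm' => hmin (h1 hm')⟩
  · rintro ⟨hk, hmin⟩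
    refine ⟨h1 hk, fun m hm => ?_⟩
    obtain ⟨m', hm', hle⟩ := h2 m hm
    exact (hmin hm').trans hle

end

/-! ### Time bounds and correctness of the two reductions. -/

theorem polyTime_coeff : PolyTime (fun i : Σ n, Circuit n => i.1)
    (fun i => [Circuit.encode i.2]) fun i => Tuple.encode (Circuit.coeff i.2) :=
  Ctx.Comp.polyTime (d := 1) (Ctx.Var.coeff (Ctx.Var.start _ _ (by norm_num : 1 < 2))
    ((PolyBound.self _).mono fun i => by simp [Ctx.start])
    (Ctx.Var.start _ _ (by norm_num : 0 < 2)).scalar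
    (Ctx.polyBound_start_param _ _ _) (Ctx.polyBound_start_pow _ _ _))

theorem polyTime_synth : PolyTime (fun i : Σ n, Tuple n => i.1)
    (fun i => [Tuple.encode i.2]) fun i => Circuit.encode i.2.synth :=
  Ctx.Comp.polyTime (d := 1) (Ctx.Var.synth (Ctx.Var.start _ _ (by norm_num : 1 < 2))
    (Ctx.Var.start _ _ (by norm_num : 0 < 2)).scalar
    (Ctx.polyBound_start_param _ _ _) (Ctx.polyBound_start_pow _ _ _))

theorem isPolyReduction_recode : IsPolyReduction tCountMinimization
    (minDistDecoding fun n => puncturedRM ((n : ℤ) - 4) n)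
    (fun _ C => Tuple.res (Circuit.coeff C)) fun _ C w => Circuit.recode C w where
  polyTime_f := Ctx.Comp.polyTime (d := 1)
    (Ctx.Var.res_coeff (C := fun i : Σ n, Circuit n => i.2)
      (Ctx.Var.start _ _ (by norm_num : 1 < 2))
      ((PolyBound.self _).mono fun i => by simp [Ctx.start, tCountMinimization])
      (Ctx.Var.start _ _ (by norm_num : 0 < 2)).scalar
      (Ctx.polyBound_start_param _ _ _) (Ctx.polyBound_start_pow _ _ _))
  polyTime_g := Ctx.Comp.polyTime (d := 2)
    (Ctx.Var.recode (C := fun i : Σ n, Circuit n × Word n => i.2.1) (w := fun i => i.2.2)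
      (Ctx.Var.start _ _ (by norm_num : 1 < 3)) (Ctx.Var.start _ _ (by norm_num : 2 < 3))
      ((PolyBound.self _).mono fun i => by
        simp only [Ctx.start, tCountMinimization, List.flatten_cons, List.length_append]
        exact le_add_left (Nat.le_add_right _ _))
      (Ctx.Var.start _ _ (by norm_num : 0 < 3)).scalar
      (Ctx.polyBound_start_param _ _ _) (Ctx.polyBound_start_pow _ _ _))
  correct _ _ _ h := isSol_recode h

theorem isPolyReduction_synth_lift : IsPolyReduction
    (minDistDecoding fun n => puncturedRM ((n : ℤ) - 4) n) tCountMinimization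
    (fun _ x => Tuple.synth (Word.lift x))
    fun _ x D => fun j => x j + Tuple.res (Circuit.coeff D) j where
  polyTime_f := Ctx.Comp.polyTime (d := 1)
    (Ctx.Var.synth (A := fun i : Σ n, Word n => i.2.lift) (k := 1)
      (by
        -- A word and its lift have the same code, so the input slot already holds the tuple.
        simp only [Word.encode_lift]
        exact Ctx.Var.start _ _ (by norm_num : 1 < 2))
      (Ctx.Var.start _ _ (by norm_num : 0 < 2)).scalar
      (Ctx.polyBound_start_param _ _ _) (Ctx.polyBound_start_pow _ _ _))
  polyTime_g := Ctx.Comp.polyTime (d := 2)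
    (Ctx.Var.add_res_coeff (C := fun i : Σ n, Word n × Circuit n => i.2.2) (w := fun i => i.2.1)
      (Ctx.Var.start _ _ (by norm_num : 1 < 3)) (Ctx.Var.start _ _ (by norm_num : 2 < 3))
      ((PolyBound.self _).mono fun i => by
        simp only [Ctx.start, tCountMinimization, List.flatten_cons, List.length_append]
        exact le_add_left (le_add_left (Nat.le_add_right _ _)))
      (Ctx.Var.start _ _ (by norm_num : 0 < 3)).scalar
      (Ctx.polyBound_start_param _ _ _) (Ctx.polyBound_start_pow _ _ _))
  correct _ _ _ h := isSol_add_res_coeff h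

end

end TCount

theorem theorem1 :
    TCount.PolyEquivalent TCount.tCountMinimization
      (TCount.minDistDecoding fun n => TCount.puncturedRM ((n : ℤ) - 4) n) ∧
    (∀ (n : ℕ) (C : TCount.Circuit n) (k : ℕ),
      IsLeast {m | ∃ D : TCount.Circuit n,
          TCount.Circuit.unitary D = TCount.Circuit.unitary C ∧ TCount.Circuit.tCount D = m} k ↔
        IsLeast {m | ∃ a : TCount.Tuple n, TCount.Implements a C ∧
          TCount.Tuple.oddCount a = m} k) ∧
    ∃ (coeff : ∀ n, TCount.Circuit n → TCount.Tuple n)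
      (synth : ∀ n, TCount.Tuple n → TCount.Circuit n)
      (recode : ∀ n, TCount.Circuit n → TCount.Word n → TCount.Circuit n),
      TCount.PolyTime (fun i : Σ n, TCount.Circuit n => i.1)
        (fun i => [TCount.Circuit.encode i.2])
        (fun i => TCount.Tuple.encode (coeff i.1 i.2)) ∧
      TCount.PolyTime (fun i : Σ n, TCount.Tuple n => i.1)
        (fun i => [TCount.Tuple.encode i.2])
        (fun i => TCount.Circuit.encode (synth i.1 i.2)) ∧
      (∀ (n : ℕ) (C : TCount.Circuit n), TCount.Implements (coeff n C) C ∧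
        TCount.Tuple.oddCount (coeff n C) ≤ TCount.Circuit.tCount C) ∧
      (∀ (n : ℕ) (a : TCount.Tuple n),
        TCount.Circuit.unitary (synth n a) = TCount.Tuple.phaseOperator a ∧
        TCount.Circuit.tCount (synth n a) = TCount.Tuple.oddCount a) ∧
      (∀ (n : ℕ) (C : TCount.Circuit n), ∀ w ∈ TCount.puncturedRM ((n : ℤ) - 4) n,
        TCount.Circuit.unitary (recode n C w) = TCount.Circuit.unitary C ∧
        TCount.Circuit.tCount (recode n C w) =
          hammingDist (TCount.Tuple.res (coeff n C)) w) ∧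
      TCount.IsPolyReduction TCount.tCountMinimization
        (TCount.minDistDecoding fun n => TCount.puncturedRM ((n : ℤ) - 4) n)
        (fun n C => TCount.Tuple.res (coeff n C))
        recode ∧
      TCount.IsPolyReduction
        (TCount.minDistDecoding fun n => TCount.puncturedRM ((n : ℤ) - 4) n)
        TCount.tCountMinimization
        (fun n x => synth n (TCount.Word.lift x))
        (fun n x D => fun j => x j + TCount.Tuple.res (coeff n D) j) := by
  refine ⟨⟨⟨_, _, TCount.isPolyReduction_recode⟩, ⟨_, _, TCount.isPolyReduction_synth_lift⟩⟩,
    fun n C k => TCount.isLeast_tCount_iff C k,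
    fun _ C => TCount.Circuit.coeff C, fun _ a => TCount.Tuple.synth a,
    fun _ C w => TCount.Circuit.recode C w, TCount.polyTime_coeff, TCount.polyTime_synth,
    fun n C => ⟨TCount.implements_coeff C, TCount.Circuit.oddCount_coeff_le C⟩,
    fun n a => ⟨TCount.Tuple.unitary_synth a, TCount.Tuple.tCount_synth a⟩,
    fun n C w hw => ⟨TCount.Circuit.unitary_recode C hw, TCount.Circuit.tCount_recode C hw⟩,
    TCount.isPolyReduction_recode, TCount.isPolyReduction_synth_lift⟩
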